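/- Let $0<p<1$, $q=1-p$, and let $\alpha_{i,j}$ ($i<j$ integers) be i.i.d. random variables with $\mathbb P(\alpha_{i,j}=1)=p$ and $\mathbb P(\alpha_{i,j}=0)=q$; an edge $(i,j)$ with $\alpha_{i,j}=1$ is called blue. For $x\in[-\infty,\infty)$ give the edge $(i,j)$ the weight $w^x_{i,j}=\alpha_{i,j}+x(1-\alpha_{i,j})$ (for $x=-\infty$: weight $1$ if $\alpha_{i,j}=1$ and $-\infty$ if $\alpha_{i,j}=0$), and let $W^x_{i,j}$ be the maximum, over all finite increasing integer sequences (paths) from $i$ to $j$, of the sum of the weights of the edges of the path. Let $C_p(x)$ be the deterministic growth rate of $W^x_{0,n}$, i.e. the almost sure and $L^1$ limit of both $W^x_{0,n}/n$ and $(W^x_{0,n})^+/n$ if $x$ is real, and of $(W^x_{0,n})^+/n$ if $x=-\infty$. An integer $i$ is a skeleton point if for all $j<i<k$ there is a path from $j$ to $k$ that contains $i$ and has only blue edges. Let $\mathcal S$ be the random set of skeleton points, and let $\Gamma_0\le 0<\Gamma_1<\Gamma_2<\cdots$ be its consecutive elements, $\Gamma_0$ being the largest one that is at most $0$. Write $i\leadsto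 j$ if there is a path from $i$ to $j$ with only blue edges, and for $n\ge 1$ let $H_{0,n}$ be the event that $0\leadsto j$ for all $0<j\le n$, that $j\leadsto n$ for all $0\le j<n$, and that for every $0<j<n$ there is an $i$ with $0<i<j$ and $i\not\leadsto j$, or an $i$ with $j<i<n$ and $j\not\leadsto i$. Then $\gamma:=\prod_{k\ge1}(1-q^k)^2$ is strictly positive and equals $\mathbb P(i\in\mathcal S)$ for every $i\in\mathbb Z$; the points $\Gamma_k$, $k\ge 0$, are almost surely well defined; and for every $x\in[-\infty,2)$ the growth rate $C_p(x)$ exists, all the expectations below exist and are finite, the series converges, and \[ C_p(x)=\gamma\,\mathbb E\bigl[W^x_{\Gamma_1,\Gamma_2}\bigr] =\gamma\,\mathbb E\bigl[W^x_{\Gamma_0,\Gamma_1}\,\big|\,\Gamma_0=0\bigr] =\gamma\sum_{n=1}^\infty\mathbb E\bigl[W^x_{0,n};H_{0,n}\bigr]. \] -/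

import Mathlib

open MeasureTheory ProbabilityTheory Filter Topology

namespace BarakErdos

/-- The edges of the complete directed graph on the integers: pairs `(i, j)` with `i < j`. -/
abbrev Edge : Type := {e : ℤ × ℤ // e.1 < e.2}

/-- The `k`-th edge of a path, a path being a finite strictly increasing sequence of integers
(`π.length` is its number of edges). -/
def pathEdge (π : LTSeries ℤ) (k : Fin π.length) : Edge :=
  ⟨(π k.castSucc, π k.succ), π.step k⟩

/-- The set of all paths from `i` to `j`. -/
def paths (i j : ℤ) : Set (LTSeries ℤ) := {π | π.head = i ∧ π.last = j}

variable {Ω : Type*}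

section Graph

variable (α : Edge → Ω → ℝ)

/-- A path is blue if all its edges `e` satisfy `α e = 1`. -/
def IsBlue (ω : Ω) (π : LTSeries ℤ) : Prop :=
  ∀ k : Fin π.length, α (pathEdge π k) ω = 1

/-- There is a blue path from `i` to `j`. -/
def Reaches (ω : Ω) (i j : ℤ) : Prop := ∃ π ∈ paths i j, IsBlue α ω π

/-- The weight `α + x (1 - α)` of an edge. In `EReal` one has `⊥ * 0 = 0`, so for `x = ⊥`
this is `1` if `α = 1` and `⊥` if `α = 0`. -/
noncomputable def edgeWeight (x : EReal) (ω : Ω) (e : Edge) : EReal :=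
  (α e ω : EReal) + x * ((1 - α e ω : ℝ) : EReal)

/-- The weight of a path: the sum of the weights of its edges. -/
noncomputable def pathWeight (x : EReal) (ω : Ω) (π : LTSeries ℤ) : EReal :=
  ∑ k : Fin π.length, edgeWeight α x ω (pathEdge π k)

/-- The maximal weight of all paths from `i` to `j` (for `i < j` there are finitely many paths,
and at least one). -/
noncomputable def W (x : EReal) (i j : ℤ) (ω : Ω) : EReal :=
  ⨆ π ∈ paths i j, pathWeight α x ω π

/-- The random set of skeleton points: `i` is one if for all `j < i < k` there is a blue path
from `j` to `k` that contains `i`. -/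
def skeleton (ω : Ω) : Set ℤ :=
  {i | ∀ j k : ℤ, j < i → i < k → ∃ π ∈ paths j k, IsBlue α ω π ∧ i ∈ π}

/-- The enumeration of the skeleton points from `Γ 0`, the largest skeleton point that is at
most `0`, on: `Γ (k + 1)` is the next skeleton point after `Γ k`. -/
noncomputable def Γ : ℕ → Ω → ℤ
  | 0, ω => sSup {s | s ∈ skeleton α ω ∧ s ≤ 0}
  | k + 1, ω => sInf {s | s ∈ skeleton α ω ∧ Γ k ω < s}

/-- Every vertex of `[0, n)` is joined to `n` by a blue path. -/
def eventA (n : ℕ) : Set Ω := {ω | ∀ j : ℤ, 0 ≤ j → j < n → Reaches α ω j n}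

/-- `0` is joined to every vertex of `(0, n]` by a blue path. -/
def eventB (n : ℕ) : Set Ω := {ω | ∀ j : ℤ, 0 < j → j ≤ n → Reaches α ω 0 j}

/-- Every vertex `j` strictly between `0` and `n` fails to be reached from some vertex of
`(0, j)`, or fails to reach some vertex of `(j, n)`. -/
def eventF (n : ℕ) : Set Ω :=
  {ω | ∀ j : ℤ, 0 < j → j < n →
    (∃ i : ℤ, 0 < i ∧ i < j ∧ ¬ Reaches α ω i j) ∨
    (∃ i : ℤ, j < i ∧ i < n ∧ ¬ Reaches α ω j i)}

/-- The inter-skeleton event on `[0, n]`. -/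
def eventH (n : ℕ) : Set Ω := eventB α n ∩ eventA α n ∩ eventF α n

end Graph

/-- `∏_{k ≥ 1} (1 - q ^ k) ^ 2` with `q = 1 - p`. -/
noncomputable def γ (p : ℝ) : ℝ := ∏' k : ℕ, (1 - (1 - p) ^ (k + 1)) ^ 2

section Expectation

variable [MeasurableSpace Ω]

/-- An extended-real random variable that is almost everywhere finite and integrable. -/
def FiniteIntegrable (f : Ω → EReal) (μ : Measure Ω) : Prop :=
  (∀ᵐ ω ∂μ, f ω ≠ ⊥ ∧ f ω ≠ ⊤) ∧ Integrable (fun ω => (f ω).toReal) μ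

/-- The integral of an extended-real random variable (meaningful if `FiniteIntegrable f μ`). -/
noncomputable def mean (f : Ω → EReal) (μ : Measure Ω) : ℝ := ∫ ω, (f ω).toReal ∂μ

/-- `Y n / n` converges to the constant `c`, almost surely and in `L¹`. -/
def TendstoRate (μ : Measure Ω) (Y : ℕ → Ω → ℝ) (c : ℝ) : Prop :=
  (∀ᵐ ω ∂μ, Tendsto (fun n : ℕ => Y n ω / n) atTop (𝓝 c)) ∧
  (∀ n, Integrable (Y n) μ) ∧
  Tendsto (fun n : ℕ => eLpNorm (fun ω => Y n ω / n - c) 1 μ) atTop (𝓝 0)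

/-- `c` is the growth rate of the maximal weight `W x 0 n`: the almost sure and `L¹` limit of
the positive part of `W x 0 n` divided by `n` and, unless `x = ⊥`, also that of `W x 0 n / n`. -/
def IsGrowthRate (μ : Measure Ω) (α : Edge → Ω → ℝ) (x : EReal) (c : ℝ) : Prop :=
  TendstoRate μ (fun n ω => (max (W α x 0 n ω) 0).toReal) c ∧
  (x ≠ ⊥ → TendstoRate μ (fun n ω => (W α x 0 n ω).toReal) c)

end Expectation

end BarakErdos

/-! A skeleton point `s` cuts the problem in two. An edge from `u < s` to `v > s` weighs at most `2`
because `x < 2`, while blue paths from `u` to `s` and from `s` to `v` weigh at least `1 + 1`. So no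
path gains by jumping over `s`, and the maximal weight is additive at skeleton points (`W_add_le`,
`W_le_add_of_mem_skeleton`).

That `a < b` are consecutive skeleton points means: everything left of `a` reaches `a`, the event
`cycle a b` holds, and `b` reaches everything on its right (`consecutive_skeleton_iff`). These three
events concern disjoint sets of edges. Hence the cycle that follows a skeleton point is independent
of the past, with law `cycleLaw`, the sum over `n` of the law on `cycle 0 n`
(`prob_inter_cycleValue`). The cycles after `Γ 1`, and the cycle after `Γ 0` given `Γ 0 = 0`, all
have this law, which gives the three formulas the same value.

A vertex reaches the next `n` vertices iff each of them, at distance `k`, receives one of `k` edges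
as a blue edge, so the probability is `∏ (1 - q ^ k)`; both sides together give `γ = ρ ^ 2`. Distant
points are asymptotically uncorrelated as skeleton points, and a second moment bound yields an
unbounded skeleton almost surely (`ae_unbounded`).

Exactly one cycle covers `0`. Summing the probabilities of its positions gives `γ * E[length] = 1`
(`gamma_mul_lintegral_lengthLaw`). The strong law for weights and for lengths of cycles, with a
sandwich of `W x 0 n` between sums over cycles, gives the rate `E[weight] / E[length] = γ *
E[weight]`. Everything is proved for the law of the configuration and then pulled back. -/

namespace BarakErdos

/-! ### Blue paths, reachability and the characterisation of skeleton points -/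

section Paths

variable {Ω : Type*} {Ω' : Type*} (α : Edge → Ω → ℝ) (α' : Edge → Ω' → ℝ)

theorem pathEdge_cons_succ (π : LTSeries ℤ) (i : ℤ) (h : i < π.head) (k : Fin π.length) :
    pathEdge (π.cons i h) ⟨k.1 + 1, by simp⟩ = pathEdge π k := by
  apply Subtype.ext
  refine Prod.ext ?_ ?_
  · exact RelSeries.cons_cast_succ π i h k.castSucc
  · exact RelSeries.cons_cast_succ π i h k.succ

theorem pathWeight_singleton (x : EReal) (ω : Ω) (i : ℤ) :
    pathWeight α x ω (RelSeries.singleton _ i) = 0 :=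
  Finset.sum_of_isEmpty (ι := Fin 0) _

theorem pathWeight_cons (x : EReal) (ω : Ω) (π : LTSeries ℤ) (i : ℤ) (h : i < π.head) :
    pathWeight α x ω (π.cons i h)
      = edgeWeight α x ω ⟨(i, π.head), h⟩ + pathWeight α x ω π := by
  have hl : (π.cons i h).length = π.length + 1 := by simp
  have h1 : pathWeight α x ω (π.cons i h)
      = ∑ k : Fin (π.length + 1), edgeWeight α x ω (pathEdge (π.cons i h) (Fin.cast hl.symm k)) :=
    (Equiv.sum_comp (finCongr hl.symm) fun k => edgeWeight α x ω (pathEdge (π.cons i h) k)).symm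
  rw [h1, Fin.sum_univ_succ]
  congr 1
  exact Finset.sum_congr rfl fun k _ => congrArg _ (pathEdge_cons_succ π i h k)

theorem isBlue_cons (ω : Ω) (π : LTSeries ℤ) (i : ℤ) (h : i < π.head) :
    IsBlue α ω (π.cons i h) ↔ α ⟨(i, π.head), h⟩ ω = 1 ∧ IsBlue α ω π := by
  have hl : (π.cons i h).length = π.length + 1 := by simp
  have h1 : IsBlue α ω (π.cons i h)
      ↔ ∀ k : Fin (π.length + 1), α (pathEdge (π.cons i h) (Fin.cast hl.symm k)) ω = 1 :=
    ⟨fun hb k => hb _, fun hb k => hb (Fin.cast hl k)⟩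
  rw [h1, Fin.forall_fin_succ]
  refine and_congr Iff.rfl (forall_congr' fun k => ?_)
  rw [← pathEdge_cons_succ π i h k]
  rfl

theorem path_induction {motive : LTSeries ℤ → Prop}
    (singleton : ∀ i, motive (RelSeries.singleton _ i))
    (cons : ∀ (π : LTSeries ℤ) (i : ℤ) (h : i < π.head), motive π → motive (π.cons i h))
    (π : LTSeries ℤ) : motive π :=
  RelSeries.inductionOn motive singleton (fun π i h hp => cons π i h hp) π

/-- There is a blue edge from `i` to `j`. -/
def Blue (ω : Ω) (i j : ℤ) : Prop := ∃ h : i < j, α ⟨(i, j), h⟩ ω = 1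

theorem reaches_refl (ω : Ω) (i : ℤ) : Reaches α ω i i :=
  ⟨RelSeries.singleton _ i, ⟨rfl, rfl⟩, fun k => k.elim0⟩

theorem reaches_iff_reflTransGen (ω : Ω) (i j : ℤ) :
    Reaches α ω i j ↔ Relation.ReflTransGen (Blue α ω) i j := by
  constructor
  · rintro ⟨π, ⟨rfl, rfl⟩, hb⟩
    induction π using path_induction with
    | singleton i => exact .refl
    | cons π i h ih =>
      rw [isBlue_cons] at hb
      have h1 : Blue α ω i π.head := ⟨h, hb.1⟩
      simpa using (ih hb.2).head h1
  · intro h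
    induction h using Relation.ReflTransGen.head_induction_on with
    | refl => exact reaches_refl α ω j
    | head h _ ih =>
      obtain ⟨h, hα⟩ := h
      obtain ⟨π, ⟨rfl, rfl⟩, hb⟩ := ih
      exact ⟨π.cons _ h, ⟨by simp, by simp⟩, (isBlue_cons α ω π _ h).2 ⟨hα, hb⟩⟩

variable {α}

theorem Reaches.trans {ω : Ω} {i j k : ℤ} (h : Reaches α ω i j) (h' : Reaches α ω j k) :
    Reaches α ω i k := by
  rw [reaches_iff_reflTransGen] at *
  exact h.trans h'

theorem Blue.reaches {ω : Ω} {i j : ℤ} (h : Blue α ω i j) : Reaches α ω i j :=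
  (reaches_iff_reflTransGen α ω i j).2 (.single h)

theorem path_head_le_last (π : LTSeries ℤ) : π.head ≤ π.last := LTSeries.head_le_last π

theorem Reaches.le {ω : Ω} {i j : ℤ} (h : Reaches α ω i j) : i ≤ j := by
  obtain ⟨π, ⟨rfl, rfl⟩, -⟩ := h
  exact path_head_le_last π

theorem reaches_of_blue_path {ω : Ω} {π : LTSeries ℤ} (hb : IsBlue α ω π) {s : ℤ} (hs : s ∈ π) :
    Reaches α ω π.head s ∧ Reaches α ω s π.last := by
  induction π using path_induction with
  | singleton i =>
    obtain ⟨k, rfl⟩ := hs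
    exact ⟨reaches_refl α ω _, reaches_refl α ω _⟩
  | cons π i h ih =>
    have hb' := (isBlue_cons α ω π i h).1 hb
    have hs' : s = i ∨ s ∈ π := by
      have := RelSeries.mem_toList.2 hs
      rw [RelSeries.toList_cons] at this
      simpa using this
    rw [RelSeries.head_cons, RelSeries.last_cons]
    rcases hs' with rfl | hs'
    · refine ⟨reaches_refl α ω _, ?_⟩
      exact ⟨π.cons s h, ⟨RelSeries.head_cons _ _ _, RelSeries.last_cons _ _ _⟩, hb⟩
    · exact ⟨(Blue.reaches ⟨h, hb'.1⟩).trans (ih hb'.2 hs').1, (ih hb'.2 hs').2⟩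

theorem exists_blue_path_through {ω : Ω} {i s j : ℤ} (h : Reaches α ω i s)
    (h' : Reaches α ω s j) : ∃ π ∈ paths i j, IsBlue α ω π ∧ s ∈ π := by
  obtain ⟨π, ⟨rfl, rfl⟩, hb⟩ := h
  induction π using path_induction with
  | singleton i =>
    obtain ⟨π', ⟨h1, h2⟩, hb'⟩ := h'
    exact ⟨π', ⟨h1, h2⟩, hb', ⟨0, h1⟩⟩
  | cons π i h ih =>
    have hb' := (isBlue_cons α ω π i h).1 hb
    obtain ⟨π', ⟨h1, h2⟩, h3, h4⟩ := ih hb'.2 (by simpa using h')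
    have h5 : i < π'.head := h1 ▸ h
    refine ⟨π'.cons i h5, ⟨by simp, by simpa using h2⟩, (isBlue_cons α ω π' i h5).2 ⟨?_, h3⟩, ?_⟩
    · simp only [h1]; exact hb'.1
    · rw [← RelSeries.mem_toList, RelSeries.toList_cons]
      simpa using Or.inr h4

/-- `i` is a skeleton point iff it is joined by blue paths to all other integers. -/
theorem mem_skeleton_iff {ω : Ω} {i : ℤ} :
    i ∈ skeleton α ω ↔ (∀ j < i, Reaches α ω j i) ∧ ∀ j > i, Reaches α ω i j := by
  constructor
  · intro h
    refine ⟨fun j hj => ?_, fun j hj => ?_⟩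
    · obtain ⟨π, ⟨rfl, -⟩, hb, hi⟩ := h j (i + 1) hj (by omega)
      exact (reaches_of_blue_path hb hi).1
    · obtain ⟨π, ⟨-, rfl⟩, hb, hi⟩ := h (i - 1) j (by omega) hj
      exact (reaches_of_blue_path hb hi).2
  · rintro ⟨h1, h2⟩ j k hj hk
    exact exists_blue_path_through (h1 j hj) (h2 k hk)

/-! ### Maximal weights -/

variable {α'}

theorem pathWeight_le_W (x : EReal) (ω : Ω) (π : LTSeries ℤ) :
    pathWeight α x ω π ≤ W α x π.head π.last ω :=
  le_iSup₂_of_le π ⟨rfl, rfl⟩ le_rfl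

theorem W_le {x : EReal} {ω : Ω} {i j : ℤ} {c : EReal}
    (h : ∀ π ∈ paths i j, pathWeight α x ω π ≤ c) : W α x i j ω ≤ c :=
  iSup₂_le h

theorem edgeWeight_le_W (x : EReal) (ω : Ω) {i j : ℤ} (h : i < j) :
    edgeWeight α x ω ⟨(i, j), h⟩ ≤ W α x i j ω := by
  let π : LTSeries ℤ := RelSeries.singleton _ j
  have h1 : pathWeight α x ω (π.cons i h) = _ := pathWeight_cons α x ω π i h
  rw [pathWeight_singleton, add_zero] at h1
  exact h1.symm.trans_le (pathWeight_le_W x ω (π.cons i h))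

theorem W_self_nonneg (x : EReal) (ω : Ω) (i : ℤ) : 0 ≤ W α x i i ω := by
  have := pathWeight_le_W (α := α) x ω (RelSeries.singleton _ i)
  rwa [pathWeight_singleton] at this

theorem W_add_le (x : EReal) (ω : Ω) (i j k : ℤ) :
    W α x i j ω + W α x j k ω ≤ W α x i k ω := by
  have key : ∀ π ∈ paths i j, ∀ π' ∈ paths j k,
      pathWeight α x ω π + pathWeight α x ω π' ≤ W α x i k ω := by
    rintro π ⟨rfl, rfl⟩ π' ⟨h, rfl⟩
    suffices H : ∃ π'' ∈ paths π.head π'.last,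
        pathWeight α x ω π'' = pathWeight α x ω π + pathWeight α x ω π' by
      obtain ⟨π'', ⟨h1, h2⟩, h3⟩ := H
      rw [← h3, ← h1, ← h2]
      exact pathWeight_le_W x ω π''
    induction π using path_induction with
    | singleton i => exact ⟨π', ⟨h, rfl⟩, by rw [pathWeight_singleton, zero_add]⟩
    | cons π i hi ih =>
      obtain ⟨π'', ⟨h1, h2⟩, h3⟩ := ih (by simpa using h)
      have h5 : i < π''.head := h1 ▸ hi
      refine ⟨π''.cons i h5, ⟨by simp, by simpa using h2⟩, ?_⟩
      rw [pathWeight_cons, pathWeight_cons, h3, add_assoc]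
      simp only [h1]
  -- Approximating both suprema from below avoids distributing addition over suprema in `EReal`, and
  -- makes the value `⊥` harmless.
  refine EReal.add_le_of_forall_lt fun a ha b hb => ?_
  simp only [W, lt_iSup_iff] at ha hb
  obtain ⟨π, hπ, ha⟩ := ha
  obtain ⟨π', hπ', hb⟩ := hb
  exact (add_le_add ha.le hb.le).trans (key π hπ π' hπ')

theorem edgeWeight_of_eq_one {x : EReal} {ω : Ω} {e : Edge} (h : α e ω = 1) :
    edgeWeight α x ω e = 1 := by
  simp [edgeWeight, h]

theorem edgeWeight_of_eq_zero {x : EReal} {ω : Ω} {e : Edge} (h : α e ω = 0) :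
    edgeWeight α x ω e = x := by
  simp [edgeWeight, h]

theorem Reaches.W_nonneg {x : EReal} {ω : Ω} {i j : ℤ} (h : Reaches α ω i j) :
    0 ≤ W α x i j ω := by
  rw [reaches_iff_reflTransGen] at h
  induction h using Relation.ReflTransGen.head_induction_on with
  | refl => exact W_self_nonneg x ω j
  | @head a b h _ ih =>
    obtain ⟨h, hα⟩ := h
    refine le_trans ?_ (W_add_le x ω a b j)
    refine add_nonneg (le_trans ?_ (edgeWeight_le_W x ω h)) ih
    rw [edgeWeight_of_eq_one hα]; exact zero_le_one

theorem Reaches.one_le_W {x : EReal} {ω : Ω} {i j : ℤ} (h : Reaches α ω i j) (hij : i < j) :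
    1 ≤ W α x i j ω := by
  rw [reaches_iff_reflTransGen] at h
  rcases h.cases_head with rfl | ⟨k, ⟨hik, hα⟩, hkj⟩
  · exact absurd hij (lt_irrefl _)
  · rw [← reaches_iff_reflTransGen] at hkj
    refine le_trans ?_ (W_add_le x ω i k j)
    have h1 := edgeWeight_le_W (α := α) x ω hik
    rw [edgeWeight_of_eq_one hα] at h1
    calc (1 : EReal) = 1 + 0 := (add_zero _).symm
      _ ≤ _ := add_le_add h1 hkj.W_nonneg

theorem edgeWeight_le_two {x : EReal} (hx : x < 2) {ω : Ω} {e : Edge}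
    (h : α e ω = 0 ∨ α e ω = 1) : edgeWeight α x ω e ≤ 2 := by
  rcases h with h | h
  · rw [edgeWeight_of_eq_zero h]; exact hx.le
  · rw [edgeWeight_of_eq_one h]; exact one_le_two

theorem W_le_two_mul {x : EReal} (hx : x < 2) {ω : Ω} (h01 : ∀ e, α e ω = 0 ∨ α e ω = 1)
    (i j : ℤ) : W α x i j ω ≤ ((2 * (j - i) : ℝ) : EReal) := by
  refine W_le ?_
  rintro π ⟨rfl, rfl⟩
  induction π using path_induction with
  | singleton i => rw [pathWeight_singleton]; simp
  | cons π i h ih =>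
    rw [pathWeight_cons, RelSeries.head_cons, RelSeries.last_cons]
    calc _ ≤ (2 : EReal) + _ := add_le_add (edgeWeight_le_two hx (h01 _)) ih
      _ = ((2 + 2 * (π.last - π.head) : ℝ) : EReal) := by rw [EReal.coe_add 2]; rfl
      _ ≤ _ := by
        rw [EReal.coe_le_coe_iff]
        have : (i : ℝ) + 1 ≤ π.head := by exact_mod_cast h
        linarith

/-- The maximal weight splits at a vertex joined by blue paths to all other vertices. -/
theorem W_le_add_of_mem_skeleton {x : EReal} (hx : x < 2) {ω : Ω}
    (h01 : ∀ e, α e ω = 0 ∨ α e ω = 1) {s : ℤ} (hs : s ∈ skeleton α ω) {i j : ℤ}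
    (hi : i ≤ s) (hj : s ≤ j) : W α x i j ω ≤ W α x i s ω + W α x s j ω := by
  rw [mem_skeleton_iff] at hs
  refine W_le ?_
  rintro π ⟨rfl, rfl⟩
  induction π using path_induction with
  | singleton i =>
    have : s = i := le_antisymm hj hi
    subst this
    rw [pathWeight_singleton]
    exact add_nonneg (W_self_nonneg x ω s) (W_self_nonneg x ω s)
  | cons π i h ih =>
    rw [RelSeries.head_cons] at hi
    rw [RelSeries.last_cons] at hj
    rw [RelSeries.head_cons, RelSeries.last_cons]
    rcases hi.eq_or_lt with rfl | hi
    · have := pathWeight_le_W (α := α) x ω (π.cons i h)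
      rw [RelSeries.head_cons, RelSeries.last_cons] at this
      calc _ ≤ _ := this
        _ = 0 + W α x i π.last ω := (zero_add _).symm
        _ ≤ _ := add_le_add (W_self_nonneg x ω i) le_rfl
    rw [pathWeight_cons]
    rcases le_or_gt π.head s with hs' | hs'
    · calc _ ≤ W α x i π.head ω + (W α x π.head s ω + W α x s π.last ω) :=
            add_le_add (edgeWeight_le_W x ω h) (ih hs' hj)
        _ = _ := (add_assoc _ _ _).symm
        _ ≤ _ := add_le_add (W_add_le x ω i π.head s) le_rfl
    -- The first edge jumps over `s`. Its weight, at most `2`, is matched by two blue paths through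
    -- `s`, each of weight at least `1`.
    · calc _ ≤ (2 : EReal) + W α x π.head π.last ω :=
            add_le_add (edgeWeight_le_two hx (h01 _)) (pathWeight_le_W x ω π)
        _ = (1 + 1) + W α x π.head π.last ω := by norm_num
        _ ≤ (W α x i s ω + W α x s π.head ω) + W α x π.head π.last ω :=
            add_le_add (add_le_add ((hs.1 i hi).one_le_W hi)
              ((hs.2 _ hs').one_le_W hs')) le_rfl
        _ = _ := add_assoc _ _ _
        _ ≤ _ := add_le_add le_rfl (W_add_le x ω s π.head π.last)

/-- Serves two purposes: `a = 0` gives locality of `W`, general `a` its covariance under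
translation. The reverse inequality follows by exchanging the roles and replacing `a` by `-a`. -/
theorem W_le_of_agree (x : EReal) {ω : Ω} {ω' : Ω'} (a i j : ℤ)
    (h : ∀ u v (huv : u < v), i ≤ u → v ≤ j →
      α ⟨(u, v), huv⟩ ω = α' ⟨(u + a, v + a), by simpa using huv⟩ ω') :
    W α x i j ω ≤ W α' x (i + a) (j + a) ω' := by
  refine W_le ?_
  rintro π ⟨rfl, rfl⟩
  induction π using path_induction with
  | singleton i => rw [pathWeight_singleton]; exact W_self_nonneg x ω' _
  | cons π i hi ih =>
    rw [pathWeight_cons, RelSeries.head_cons, RelSeries.last_cons]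
    rw [RelSeries.head_cons, RelSeries.last_cons] at h
    have h1 := ih fun u v huv hu hv => h u v huv (hi.le.trans hu) hv
    refine le_trans (add_le_add ?_ h1) (W_add_le x ω' _ (π.head + a) _)
    have h2 : i + a < π.head + a := by simpa using hi
    refine le_trans (le_of_eq ?_) (edgeWeight_le_W (α := α') x ω' h2)
    simp only [edgeWeight, h i π.head hi le_rfl (path_head_le_last π)]

theorem W_eq_of_agree (x : EReal) {ω : Ω} {ω' : Ω'} (a i j : ℤ)
    (h : ∀ u v (huv : u < v), i ≤ u → v ≤ j →
      α ⟨(u, v), huv⟩ ω = α' ⟨(u + a, v + a), by simpa using huv⟩ ω') :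
    W α x i j ω = W α' x (i + a) (j + a) ω' := by
  refine le_antisymm (W_le_of_agree x a i j h) ?_
  have := W_le_of_agree (α := α') (α' := α) (ω := ω') (ω' := ω) x (-a) (i + a) (j + a)
    (fun u v huv hu hv => by
      rw [h (u + -a) (v + -a) (by simpa using huv) (by omega) (by omega)]
      simp)
  simpa using this

theorem Reaches.of_agree {ω : Ω} {ω' : Ω'} (a : ℤ) {i j : ℤ}
    (h : ∀ u v (huv : u < v), i ≤ u → v ≤ j →
      α ⟨(u, v), huv⟩ ω = α' ⟨(u + a, v + a), by simpa using huv⟩ ω')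
    (hr : Reaches α ω i j) : Reaches α' ω' (i + a) (j + a) := by
  rw [reaches_iff_reflTransGen] at *
  induction hr using Relation.ReflTransGen.head_induction_on with
  | refl => exact .refl
  | @head b c hb hcj ih =>
    obtain ⟨hb, hα⟩ := hb
    have hcj := ((reaches_iff_reflTransGen α ω c j).2 hcj).le
    refine (ih fun u v huv hu hv => h u v huv (hb.le.trans hu) hv).head ?_
    exact ⟨by simpa using hb, by rw [← hα, h b c hb le_rfl hcj]⟩

theorem reaches_iff_of_agree {ω : Ω} {ω' : Ω'} (a : ℤ) {i j : ℤ}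
    (h : ∀ u v (huv : u < v), i ≤ u → v ≤ j →
      α ⟨(u, v), huv⟩ ω = α' ⟨(u + a, v + a), by simpa using huv⟩ ω') :
    Reaches α ω i j ↔ Reaches α' ω' (i + a) (j + a) := by
  refine ⟨Reaches.of_agree a h, fun hr => ?_⟩
  have := Reaches.of_agree (α := α') (α' := α) (ω := ω') (ω' := ω) (-a) (i := i + a) (j := j + a)
    (fun u v huv hu hv => by
      rw [h (u + -a) (v + -a) (by simpa using huv) (by omega) (by omega)]
      simp) hr
  simpa using this

end Paths

/-! ### Configurations of edge values -/

/-- A configuration assigns a value to every edge. -/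
abbrev Cfg : Type := Edge → ℝ

/-- The coordinate maps on configurations. -/
def coord : Edge → Cfg → ℝ := fun e c => c e

/-- The edges in `(-∞, a]`. -/
def edgesLE (a : ℤ) : Set Edge := {e | e.1.2 ≤ a}

/-- The edges in `[a, ∞)`. -/
def edgesGE (a : ℤ) : Set Edge := {e | a ≤ e.1.1}

/-- The edges in `[a, b]`. -/
def edgesIcc (a b : ℤ) : Set Edge := {e | a ≤ e.1.1 ∧ e.1.2 ≤ b}

/-- `i` is joined to all vertices of `(i, n]`. -/
def rightTo (i n : ℤ) : Set Cfg := {c | ∀ j, i < j → j ≤ n → Reaches coord c i j}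

/-- All vertices of `[n, i)` are joined to `i`. -/
def leftFrom (n i : ℤ) : Set Cfg := {c | ∀ j, n ≤ j → j < i → Reaches coord c j i}

/-- `i` is joined to all vertices to its right. -/
def rightAll (i : ℤ) : Set Cfg := {c | ∀ j, i < j → Reaches coord c i j}

/-- All vertices to the left of `i` are joined to `i`. -/
def leftAll (i : ℤ) : Set Cfg := {c | ∀ j, j < i → Reaches coord c j i}

/-- No vertex strictly between `a` and `b` is connected to all others strictly between. -/
def flawed (a b : ℤ) : Set Cfg :=
  {c | ∀ j : ℤ, a < j → j < b →
    (∃ i : ℤ, a < i ∧ i < j ∧ ¬ Reaches coord c i j) ∨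
    (∃ i : ℤ, j < i ∧ i < b ∧ ¬ Reaches coord c j i)}

/-- The inter-skeleton event on `[a, b]`. -/
def cycle (a b : ℤ) : Set Cfg := rightTo a b ∩ leftFrom a b ∩ flawed a b

/-- `a` and `b` are elements of `S` with no other element of `S` between them. -/
def Consecutive (S : Set ℤ) (a b : ℤ) : Prop :=
  a ∈ S ∧ b ∈ S ∧ ∀ j, a < j → j < b → j ∉ S

theorem eventH_coord (n : ℕ) : eventH coord n = cycle 0 n := rfl

theorem mem_skeleton_iff_mem_inter {c : Cfg} {i : ℤ} :
    i ∈ skeleton coord c ↔ c ∈ leftAll i ∩ rightAll i := mem_skeleton_iff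

/-- A vertex strictly between `a` and `b` is joined to everything outside through `a` or `b`, so
whether it is a skeleton point is decided inside `(a, b)`. The three events on the right depend on
disjoint sets of edges. -/
theorem consecutive_skeleton_iff {c : Cfg} {a b : ℤ} (hab : a < b) :
    Consecutive (skeleton coord c) a b ↔ c ∈ leftAll a ∩ cycle a b ∩ rightAll b := by
  simp only [Consecutive, mem_skeleton_iff_mem_inter]
  constructor
  · rintro ⟨⟨hla, hra⟩, ⟨hlb, hrb⟩, hj⟩
    refine ⟨⟨hla, ⟨fun j h _ => hra j h, fun j _ h => hlb j h⟩, fun j haj hjb => ?_⟩, hrb⟩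
    by_contra! hcon
    refine hj j haj hjb ⟨fun i hi => ?_, fun i hi => ?_⟩
    · rcases lt_trichotomy i a with h | rfl | h
      · exact (hla i h).trans (hra j haj)
      · exact hra j haj
      · exact hcon.1 i h hi
    · rcases lt_trichotomy b i with h | rfl | h
      · exact (hlb j hjb).trans (hrb i h)
      · exact hlb j hjb
      · exact hcon.2 i hi h
  · rintro ⟨⟨hla, ⟨hr, hl⟩, hf⟩, hrb⟩
    have hab' := hr b hab le_rfl
    refine ⟨⟨hla, fun i hi => ?_⟩, ⟨fun i hi => ?_, hrb⟩, fun j haj hjb hj => ?_⟩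
    · rcases le_or_gt i b with h | h
      · exact hr i hi h
      · exact hab'.trans (hrb i h)
    · rcases le_or_gt a i with h | h
      · exact hl i h hi
      · exact (hla i h).trans hab'
    · rcases hf j haj hjb with ⟨i, _, hij, hn⟩ | ⟨i, hji, _, hn⟩
      · exact hn (hj.1 i hij)
      · exact hn (hj.2 i hji)

/-! ### Local criteria -/

/-- Tracing blue edges backwards from `j` within `[i, j]` must end at `i`. For different `j` the
conditions involve disjoint sets of edges, which makes the probability a product. -/
theorem mem_rightTo_iff {c : Cfg} {i n : ℤ} :
    c ∈ rightTo i n ↔ ∀ j, i < j → j ≤ n → ∃ l, i ≤ l ∧ Blue coord c l j := by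
  constructor
  · intro h j hij hjn
    have := h j hij hjn
    rw [reaches_iff_reflTransGen] at this
    rcases this.cases_tail with rfl | ⟨l, hil, hlj⟩
    · exact absurd hij (lt_irrefl _)
    · exact ⟨l, ((reaches_iff_reflTransGen _ c _ _).2 hil).le, hlj⟩
  · intro h j hij hjn
    obtain ⟨k, rfl⟩ : ∃ k : ℕ, j = i + k := ⟨(j - i).toNat, by omega⟩
    induction k using Nat.strong_induction_on with
    | _ k ih =>
      obtain ⟨l, hil, hl⟩ := h _ hij hjn
      have hlj := hl.1
      rcases hil.eq_or_lt with rfl | hil'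
      · exact hl.reaches
      · obtain ⟨m, rfl⟩ : ∃ m : ℕ, l = i + m := ⟨(l - i).toNat, by omega⟩
        exact (ih m (by omega) hil' (by omega)).trans hl.reaches

theorem reaches_congr {c c' : Cfg} {i j : ℤ} (h : ∀ e ∈ edgesIcc i j, c e = c' e) :
    Reaches coord c i j ↔ Reaches coord c' i j := by
  have := reaches_iff_of_agree (α := coord) (α' := coord) (ω := c) (ω' := c') 0 (i := i) (j := j)
    (fun u v huv hu hv => by simpa [coord] using h ⟨(u, v), huv⟩ ⟨hu, hv⟩)
  simpa using this

theorem W_congr (x : EReal) {c c' : Cfg} {i j : ℤ} (h : ∀ e ∈ edgesIcc i j, c e = c' e) :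
    W coord x i j c = W coord x i j c' := by
  have := W_eq_of_agree (α := coord) (α' := coord) (ω := c) (ω' := c') x 0 i j
    (fun u v huv hu hv => by simpa [coord] using h ⟨(u, v), huv⟩ ⟨hu, hv⟩)
  simpa using this

theorem dependsOn_rightTo (i n : ℤ) : DependsOn (· ∈ rightTo i n) (edgesIcc i n) := by
  intro c c' h
  refine propext (forall_congr' fun j => forall_congr' fun _ => forall_congr' fun hj => ?_)
  exact reaches_congr fun e he => h e ⟨he.1, he.2.trans hj⟩

theorem dependsOn_leftFrom (n i : ℤ) : DependsOn (· ∈ leftFrom n i) (edgesIcc n i) := by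
  intro c c' h
  refine propext (forall_congr' fun j => forall_congr' fun hj => forall_congr' fun _ => ?_)
  exact reaches_congr fun e he => h e ⟨hj.trans he.1, he.2⟩

theorem dependsOn_rightAll (i : ℤ) : DependsOn (· ∈ rightAll i) (edgesGE i) := by
  intro c c' h
  refine propext (forall_congr' fun j => forall_congr' fun _ => ?_)
  exact reaches_congr fun e he => h e he.1

theorem dependsOn_leftAll (i : ℤ) : DependsOn (· ∈ leftAll i) (edgesLE i) := by
  intro c c' h
  refine propext (forall_congr' fun j => forall_congr' fun _ => ?_)
  exact reaches_congr fun e he => h e he.2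

theorem dependsOn_flawed (a b : ℤ) : DependsOn (· ∈ flawed a b) (edgesIcc a b) := by
  intro c c' h
  refine propext (forall_congr' fun j => forall_congr' fun haj => forall_congr' fun hjb => ?_)
  refine or_congr ?_ ?_
  · refine exists_congr fun i => and_congr_right fun hi => and_congr_right fun hij =>
      not_congr (reaches_congr fun e he => h e ⟨hi.le.trans he.1, he.2.trans hjb.le⟩)
  · refine exists_congr fun i => and_congr_right fun hji => and_congr_right fun hib =>
      not_congr (reaches_congr fun e he => h e ⟨haj.le.trans he.1, he.2.trans hib.le⟩)

theorem _root_.DependsOn.mem_inter {ι : Type*} {X : ι → Type*} {E F : Set (∀ i, X i)} {J : Set ι}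
    (hE : DependsOn (· ∈ E) J) (hF : DependsOn (· ∈ F) J) : DependsOn (· ∈ E ∩ F) J :=
  fun _ _ h => propext (and_congr (iff_of_eq (hE h)) (iff_of_eq (hF h)))

theorem dependsOn_cycle (a b : ℤ) : DependsOn (· ∈ cycle a b) (edgesIcc a b) :=
  ((dependsOn_rightTo a b).mem_inter (dependsOn_leftFrom a b)).mem_inter (dependsOn_flawed a b)

/-! ### Shifts and reflection -/

/-- Translation of edges. -/
def shiftEdge (a : ℤ) (e : Edge) : Edge := ⟨(e.1.1 + a, e.1.2 + a), by simpa using e.2⟩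

/-- The reflection `i ↦ -i` of edges. -/
def reflectEdge (e : Edge) : Edge := ⟨(-e.1.2, -e.1.1), by simpa using e.2⟩

theorem shiftEdge_injective (a : ℤ) : Function.Injective (shiftEdge a) := by
  intro e e' h
  have h1 := congrArg (fun e : Edge => e.1.1) h
  have h2 := congrArg (fun e : Edge => e.1.2) h
  exact Subtype.ext (Prod.ext (by simpa [shiftEdge] using h1) (by simpa [shiftEdge] using h2))

theorem reflectEdge_injective : Function.Injective reflectEdge := by
  intro e e' h
  have h1 := congrArg (fun e : Edge => e.1.1) h
  have h2 := congrArg (fun e : Edge => e.1.2) h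
  exact Subtype.ext (Prod.ext (by simpa [reflectEdge] using h2) (by simpa [reflectEdge] using h1))

theorem reaches_shift (c : Cfg) (a i j : ℤ) :
    Reaches coord (c ∘ shiftEdge a) i j ↔ Reaches coord c (i + a) (j + a) :=
  reaches_iff_of_agree a fun _ _ _ _ _ => rfl

theorem W_shift (x : EReal) (c : Cfg) (a i j : ℤ) :
    W coord x i j (c ∘ shiftEdge a) = W coord x (i + a) (j + a) c :=
  W_eq_of_agree x a i j fun _ _ _ _ _ => rfl

theorem blue_reflect (c : Cfg) (i j : ℤ) :
    Blue coord (c ∘ reflectEdge) i j ↔ Blue coord c (-j) (-i) := by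
  constructor
  · rintro ⟨h, hc⟩
    exact ⟨by omega, hc⟩
  · rintro ⟨h, hc⟩
    exact ⟨by omega, hc⟩

theorem reaches_reflect (c : Cfg) (i j : ℤ) :
    Reaches coord (c ∘ reflectEdge) i j ↔ Reaches coord c (-j) (-i) := by
  rw [reaches_iff_reflTransGen, reaches_iff_reflTransGen]
  constructor
  · intro h
    induction h with
    | refl => exact .refl
    | tail _ h ih => exact ih.head ((blue_reflect c _ _).1 h)
  · intro h
    rw [← neg_neg i, ← neg_neg j]
    generalize -i = i' at *
    generalize -j = j' at *
    induction h with
    | refl => exact .refl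
    | tail _ h ih =>
      refine ih.head ((blue_reflect c _ _).2 ?_)
      simpa using h

/-- Reduces probabilities of left connections to those of right connections. -/
theorem leftFrom_reflect (c : Cfg) (n i : ℤ) :
    c ∘ reflectEdge ∈ leftFrom n i ↔ c ∈ rightTo (-i) (-n) := by
  constructor
  · intro h j hj hj'
    have := (reaches_reflect c _ _).1 (h (-j) (by omega) (by omega))
    rwa [neg_neg] at this
  · intro h j hj hj'
    exact (reaches_reflect c _ _).2 (h (-j) (by omega) (by omega))

theorem rightTo_shift (c : Cfg) (a i n : ℤ) :
    c ∘ shiftEdge a ∈ rightTo i n ↔ c ∈ rightTo (i + a) (n + a) := by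
  constructor
  · intro h j hj hj'
    have := (reaches_shift c a _ _).1 (h (j - a) (by omega) (by omega))
    rwa [sub_add_cancel] at this
  · intro h j hj hj'
    exact (reaches_shift c a _ _).2 (h _ (by omega) (by omega))

theorem leftFrom_shift (c : Cfg) (a n i : ℤ) :
    c ∘ shiftEdge a ∈ leftFrom n i ↔ c ∈ leftFrom (n + a) (i + a) := by
  constructor
  · intro h j hj hj'
    have := (reaches_shift c a _ _).1 (h (j - a) (by omega) (by omega))
    rwa [sub_add_cancel] at this
  · intro h j hj hj'
    exact (reaches_shift c a _ _).2 (h _ (by omega) (by omega))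

theorem flawed_shift (c : Cfg) (a i j : ℤ) :
    c ∘ shiftEdge a ∈ flawed i j ↔ c ∈ flawed (i + a) (j + a) := by
  constructor
  · intro h k hk hk'
    rcases h (k - a) (by omega) (by omega) with ⟨l, h1, h2, h3⟩ | ⟨l, h1, h2, h3⟩
    · rw [reaches_shift, sub_add_cancel] at h3
      exact .inl ⟨l + a, by omega, by omega, h3⟩
    · rw [reaches_shift, sub_add_cancel] at h3
      exact .inr ⟨l + a, by omega, by omega, h3⟩
  · intro h k hk hk'
    rcases h (k + a) (by omega) (by omega) with ⟨l, h1, h2, h3⟩ | ⟨l, h1, h2, h3⟩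
    · rw [← sub_add_cancel l a, ← reaches_shift] at h3
      exact .inl ⟨l - a, by omega, by omega, h3⟩
    · rw [← sub_add_cancel l a, ← reaches_shift] at h3
      exact .inr ⟨l - a, by omega, by omega, h3⟩

theorem cycle_shift (c : Cfg) (a i j : ℤ) :
    c ∘ shiftEdge a ∈ cycle i j ↔ c ∈ cycle (i + a) (j + a) :=
  and_congr (and_congr (rightTo_shift c a i j) (leftFrom_shift c a i j)) (flawed_shift c a i j)

/-! ### Enumeration of a set of integers -/

/-- The enumeration of a set of integers, from its largest element that is at most `0`. -/
noncomputable def enum (S : Set ℤ) : ℕ → ℤ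
  | 0 => sSup {s | s ∈ S ∧ s ≤ 0}
  | k + 1 => sInf {s | s ∈ S ∧ enum S k < s}

theorem Γ_eq_enum {Ω : Type*} (α : Edge → Ω → ℝ) (ω : Ω) (k : ℕ) :
    Γ α k ω = enum (skeleton α ω) k := by
  induction k with
  | zero => rfl
  | succ k ih => rw [Γ, enum, ih]

/-- A set of integers without upper or lower bound. -/
def Unbounded (S : Set ℤ) : Prop := (∀ a, ∃ s ∈ S, s < a) ∧ ∀ a, ∃ s ∈ S, a < s

section Enum

variable {S S' : Set ℤ}

theorem isLeast_enum_succ (h : ∀ a, ∃ s ∈ S, a < s) (k : ℕ) :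
    IsLeast {s | s ∈ S ∧ enum S k < s} (enum S (k + 1)) := by
  have hne : {s | s ∈ S ∧ enum S k < s}.Nonempty := (h _).imp fun s hs => hs
  have hbd : BddBelow {s | s ∈ S ∧ enum S k < s} := ⟨enum S k, fun s hs => hs.2.le⟩
  exact ⟨Int.csInf_mem hne hbd, fun s hs => csInf_le hbd hs⟩

theorem isGreatest_enum_zero (h : ∀ a, ∃ s ∈ S, s < a) :
    IsGreatest {s | s ∈ S ∧ s ≤ 0} (enum S 0) := by
  have hne : {s | s ∈ S ∧ s ≤ 0}.Nonempty := (h 0).imp fun s hs => ⟨hs.1, hs.2.le⟩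
  have hbd : BddAbove {s | s ∈ S ∧ s ≤ 0} := ⟨0, fun s hs => hs.2⟩
  exact ⟨Int.csSup_mem hne hbd, fun s hs => le_csSup hbd hs⟩

theorem enum_mem (h : Unbounded S) (k : ℕ) : enum S k ∈ S := by
  cases k with
  | zero => exact (isGreatest_enum_zero h.1).1.1
  | succ k => exact (isLeast_enum_succ h.2 k).1.1

theorem enum_strictMono (h : ∀ a, ∃ s ∈ S, a < s) : StrictMono (enum S) :=
  strictMono_nat_of_lt_succ fun k => (isLeast_enum_succ h k).1.2

theorem enum_one_pos (h : Unbounded S) : 0 < enum S 1 := by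
  by_contra! hle
  have h1 := isLeast_enum_succ h.2 0
  exact absurd ((isGreatest_enum_zero h.1).2 ⟨h1.1.1, hle⟩) (not_le.2 h1.1.2)

theorem consecutive_enum (h : Unbounded S) (k : ℕ) :
    Consecutive S (enum S k) (enum S (k + 1)) :=
  ⟨enum_mem h k, enum_mem h (k + 1),
    fun _ h1 h2 h3 => absurd ((isLeast_enum_succ h.2 k).2 ⟨h3, h1⟩) (not_le.2 h2)⟩

theorem enum_succ_of_consecutive (h : ∀ a, ∃ s ∈ S, a < s) {k : ℕ} {b : ℤ}
    (hb : enum S k < b) (hc : Consecutive S (enum S k) b) : enum S (k + 1) = b := by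
  refine (isLeast_enum_succ h k).unique ⟨⟨hc.2.1, hb⟩, fun s hs => ?_⟩
  by_contra! hlt
  exact hc.2.2 s hs.2 hlt hs.1

theorem enum_zero_of_consecutive (h : ∀ a, ∃ s ∈ S, s < a) {a b : ℤ} (ha : a ≤ 0) (hb : 0 < b)
    (hc : Consecutive S a b) : enum S 0 = a := by
  refine (isGreatest_enum_zero h).unique ⟨⟨hc.1, ha⟩, fun s hs => ?_⟩
  by_contra! hlt
  exact hc.2.2 s hlt (hs.2.trans_lt hb) hs.1

theorem enum_zero_of_zero_mem (h : (0 : ℤ) ∈ S) : enum S 0 = 0 :=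
  IsGreatest.csSup_eq ⟨⟨h, le_rfl⟩, fun _ hs => hs.2⟩

/-- `0 ≤ a` ensures that the starting point, the largest element up to `0`, is seen below `a`.
Neither set has to be unbounded below. -/
theorem enum_congr (h : ∀ a, ∃ s ∈ S, a < s) (h' : ∀ a, ∃ s ∈ S', a < s) {a : ℤ} (ha : 0 ≤ a)
    (hS : ∀ s ≤ a, s ∈ S ↔ s ∈ S') {k : ℕ} (hk : enum S k ≤ a) : enum S' k = enum S k := by
  induction k with
  | zero =>
    simp only [enum]
    congr 1
    ext s
    exact and_congr_left fun hs => (hS s (hs.trans ha)).symm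
  | succ k ih =>
    have h1 := isLeast_enum_succ h k
    have h2 := ih ((h1.1.2.le).trans hk)
    refine (isLeast_enum_succ h' k).unique ⟨⟨(hS _ hk).1 h1.1.1, h2 ▸ h1.1.2⟩, fun s hs => ?_⟩
    by_contra! hlt
    have := h1.2 ⟨(hS s (hlt.le.trans hk)).2 hs.1, h2 ▸ hs.2⟩
    exact absurd this (not_le.2 hlt)

end Enum

/-! ### Truncation -/

/-- The configuration that agrees with `c` on `(-∞, a]` and is blue elsewhere. -/
def trunc (a : ℤ) (c : Cfg) : Cfg := fun e => if e.1.2 ≤ a then c e else 1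

theorem trunc_apply {a : ℤ} {c : Cfg} {e : Edge} (h : e ∈ edgesLE a) : trunc a c e = c e :=
  if_pos h

theorem blue_trunc {a : ℤ} {c : Cfg} {i j : ℤ} (hij : i < j) (hj : a < j) :
    Blue coord (trunc a c) i j :=
  ⟨hij, if_neg (not_le.2 hj)⟩

theorem reaches_trunc {a : ℤ} {c : Cfg} {i j : ℤ} (hj : j ≤ a) :
    Reaches coord (trunc a c) i j ↔ Reaches coord c i j :=
  reaches_congr fun _ he => trunc_apply (he.2.trans hj)

/-- Beyond `a` connections come for free: in `c` through the skeleton point `a`, in the truncation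
by a single blue edge. Up to `a` the two configurations coincide. -/
theorem mem_skeleton_trunc_iff {a : ℤ} {c : Cfg} (ha : a ∈ skeleton coord c) {i : ℤ}
    (hi : i ≤ a) : i ∈ skeleton coord c ↔ i ∈ skeleton coord (trunc a c) := by
  rw [mem_skeleton_iff] at ha ⊢
  rw [mem_skeleton_iff]
  constructor
  · rintro ⟨hl, hr⟩
    refine ⟨fun j hj => (reaches_trunc hi).2 (hl j hj), fun j hj => ?_⟩
    rcases le_or_gt j a with h | h
    · exact (reaches_trunc h).2 (hr j hj)
    · exact (blue_trunc hj h).reaches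
  · rintro ⟨hl, hr⟩
    refine ⟨fun j hj => (reaches_trunc hi).1 (hl j hj), fun j hj => ?_⟩
    rcases le_or_gt j a with h | h
    · exact (reaches_trunc h).1 (hr j hj)
    · rcases hi.eq_or_lt with rfl | hi
      · exact ha.2 j h
      · exact ((reaches_trunc le_rfl).1 (hr a hi)).trans (ha.2 j h)

theorem mem_skeleton_trunc_of_lt {a : ℤ} {c : Cfg} {i : ℤ} (hi : a < i) :
    i ∈ skeleton coord (trunc a c) :=
  mem_skeleton_iff.2 ⟨fun _ hj => (blue_trunc hj hi).reaches,
    fun _ hj => (blue_trunc hj (hi.trans hj)).reaches⟩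

/-- Setting the remaining edges to blue, rather than to `0`, keeps the enumeration of the truncated
skeleton free of default values of `sInf`. -/
theorem skeleton_trunc_unbounded_above (a : ℤ) (c : Cfg) (b : ℤ) :
    ∃ s ∈ skeleton coord (trunc a c), b < s :=
  ⟨max a b + 1, mem_skeleton_trunc_of_lt (by omega), by omega⟩

theorem enum_trunc_eq {a : ℤ} {c : Cfg} (h0 : 0 ≤ a) (ha : a ∈ skeleton coord c)
    (hc : ∀ b, ∃ s ∈ skeleton coord c, b < s) {k : ℕ} (hk : enum (skeleton coord c) k ≤ a) :
    enum (skeleton coord (trunc a c)) k = enum (skeleton coord c) k :=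
  enum_congr hc (skeleton_trunc_unbounded_above a c) h0 (fun _ hs => mem_skeleton_trunc_iff ha hs)
    hk

/-- Unlike in `enum_trunc_eq`, the bound is on the truncated side, so the index of a skeleton point
can be read off from the edges in `(-∞, a]`. -/
theorem enum_trunc_eq' {a : ℤ} {c : Cfg} (h0 : 0 ≤ a) (ha : a ∈ skeleton coord c)
    (hc : ∀ b, ∃ s ∈ skeleton coord c, b < s) {k : ℕ}
    (hk : enum (skeleton coord (trunc a c)) k ≤ a) :
    enum (skeleton coord (trunc a c)) k = enum (skeleton coord c) k :=
  (enum_congr (skeleton_trunc_unbounded_above a c) hc h0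
    (fun _ hs => (mem_skeleton_trunc_iff ha hs).symm) hk).symm

theorem dependsOn_trunc_preimage (a : ℤ) (E : Set Cfg) :
    DependsOn (· ∈ trunc a ⁻¹' E) (edgesLE a) := by
  intro c c' h
  have : trunc a c = trunc a c' := by
    funext e
    by_cases he : e.1.2 ≤ a
    · simp [trunc, he, h e he]
    · simp [trunc, he]
  simp [Set.mem_preimage, this]

/-! ### Measurability -/

/-- Turns existence of blue paths and suprema over paths into countable operations. -/
instance : Countable (LTSeries ℤ) := RelSeries.toList_injective.countable

theorem measurable_coord (e : Edge) : Measurable (coord e) := measurable_pi_apply e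

theorem measurable_edgeWeight (x : EReal) (e : Edge) :
    Measurable fun c => edgeWeight coord x c e := by
  unfold edgeWeight
  have h := measurable_coord e
  fun_prop

theorem measurable_W (x : EReal) (i j : ℤ) : Measurable (W coord x i j) :=
  Measurable.biSup _ (Set.to_countable _) fun _ _ =>
    Finset.measurable_sum _ fun _ _ => measurable_edgeWeight x _

theorem measurable_coord_eq (e : Edge) (r : ℝ) : Measurable fun c => coord e c = r :=
  measurableSet_setOfPred.1 (measurable_coord e (measurableSet_singleton r))

theorem measurable_blue (i j : ℤ) : Measurable fun c => Blue coord c i j :=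
  Measurable.exists fun _ => measurable_coord_eq _ 1

theorem measurable_reaches (i j : ℤ) : Measurable fun c => Reaches coord c i j :=
  Measurable.exists fun _ => Measurable.and measurable_const
    (Measurable.forall fun _ => measurable_coord_eq _ 1)

theorem measurableSet_rightTo (i n : ℤ) : MeasurableSet (rightTo i n) :=
  measurableSet_setOfPred.2 <| Measurable.forall fun j => measurable_const.imp <|
    measurable_const.imp (measurable_reaches i j)

theorem measurableSet_leftFrom (n i : ℤ) : MeasurableSet (leftFrom n i) :=
  measurableSet_setOfPred.2 <| Measurable.forall fun j => measurable_const.imp <|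
    measurable_const.imp (measurable_reaches j i)

theorem measurableSet_rightAll (i : ℤ) : MeasurableSet (rightAll i) :=
  measurableSet_setOfPred.2 <| Measurable.forall fun j =>
    measurable_const.imp (measurable_reaches i j)

theorem measurableSet_leftAll (i : ℤ) : MeasurableSet (leftAll i) :=
  measurableSet_setOfPred.2 <| Measurable.forall fun j =>
    measurable_const.imp (measurable_reaches j i)

theorem measurableSet_flawed (a b : ℤ) : MeasurableSet (flawed a b) :=
  measurableSet_setOfPred.2 <| Measurable.forall fun j => measurable_const.imp <|
    measurable_const.imp <| Measurable.or
      (Measurable.exists fun i => measurable_const.and <| measurable_const.and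
        (measurable_reaches i j).not)
      (Measurable.exists fun i => measurable_const.and <| measurable_const.and
        (measurable_reaches j i).not)

theorem measurableSet_cycle (a b : ℤ) : MeasurableSet (cycle a b) :=
  ((measurableSet_rightTo a b).inter (measurableSet_leftFrom a b)).inter (measurableSet_flawed a b)

theorem measurable_mem_skeleton (i : ℤ) : Measurable fun c => i ∈ skeleton coord c := by
  simp only [mem_skeleton_iff_mem_inter]
  exact measurableSet_setOfPred.1 ((measurableSet_leftAll i).inter (measurableSet_rightAll i))

theorem measurable_sSup_int {X : Type*} [MeasurableSpace X] {T : X → Set ℤ}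
    (h : ∀ s, Measurable fun c => s ∈ T c) : Measurable fun c => sSup (T c) := by
  have key : ∀ (S : Set ℤ) (a : ℤ),
      -- In `ℤ` the supremum of an empty or unbounded set is the default value `0`. Both
      -- alternatives are countable combinations of membership conditions.
      sSup S = a ↔ IsGreatest S a ∨ (¬ ∃ b, IsGreatest S b) ∧ a = 0 := by
    intro S a
    by_cases hS : S.Nonempty ∧ BddAbove S
    · have h1 : IsGreatest S (sSup S) :=
        ⟨Int.csSup_mem hS.1 hS.2, fun s hs => le_csSup hS.2 hs⟩
      constructor
      · rintro rfl
        exact .inl h1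
      · rintro (h2 | h2)
        · exact h1.unique h2
        · exact absurd ⟨_, h1⟩ h2.1
    · have h1 : ¬ ∃ b, IsGreatest S b := fun ⟨b, hb⟩ => hS ⟨⟨b, hb.1⟩, ⟨b, hb.2⟩⟩
      have h2 : sSup S = 0 := by
        rcases S.eq_empty_or_nonempty with rfl | hne
        · exact Int.csSup_empty
        · exact Int.csSup_of_not_bddAbove fun hb => hS ⟨hne, hb⟩
      rw [h2]
      constructor
      · rintro rfl
        exact .inr ⟨h1, rfl⟩
      · rintro (h3 | h3)
        · exact absurd ⟨a, h3⟩ h1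
        · exact h3.2.symm
  have hG : ∀ a, Measurable fun c => IsGreatest (T c) a := fun a =>
    (h a).and (Measurable.forall fun s => (h s).imp measurable_const)
  refine measurable_to_countable' fun a => ?_
  have : (fun c => sSup (T c)) ⁻¹' {a}
      = {c | IsGreatest (T c) a ∨ (¬ ∃ b, IsGreatest (T c) b) ∧ a = 0} :=
    Set.ext fun c => key (T c) a
  rw [this]
  exact measurableSet_setOfPred.2
    ((hG a).or ((Measurable.exists hG).not.and measurable_const))

theorem measurable_sInf_int {X : Type*} [MeasurableSpace X] {T : X → Set ℤ}
    (h : ∀ s, Measurable fun c => s ∈ T c) : Measurable fun c => sInf (T c) := by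
  have key : ∀ S : Set ℤ, sInf S = -sSup {s | -s ∈ S} := by
    intro S
    change _ = -sSup (-S)
    rcases S.eq_empty_or_nonempty with rfl | hne
    · simp
    by_cases hb : BddBelow S
    · rw [csSup_neg hne hb, neg_neg]
    · rw [Int.csInf_of_not_bddBelow hb, Int.csSup_of_not_bddAbove (by simpa using hb), neg_zero]
  simp only [key]
  exact (measurable_sSup_int fun s => h (-s)).neg

/-- The `k`-th enumerated skeleton point of a configuration. -/
noncomputable def pt (k : ℕ) (c : Cfg) : ℤ := enum (skeleton coord c) k

theorem measurable_pt (k : ℕ) : Measurable (pt k) := by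
  induction k with
  | zero =>
    exact measurable_sSup_int fun s => (measurable_mem_skeleton s).and measurable_const
  | succ k ih =>
    refine measurable_sInf_int fun s => (measurable_mem_skeleton s).and ?_
    exact measurableSet_setOfPred.1 (measurableSet_lt ih measurable_const)

/-- The random indices take countably many values, so no joint regularity of `f` is needed. -/
theorem measurable_comp_pt {β : Type*} [MeasurableSpace β] {f : ℤ → ℤ → Cfg → β}
    (hf : ∀ i j, Measurable (f i j)) (k l : ℕ) :
    Measurable fun c => f (pt k c) (pt l c) c := by
  have h : Measurable fun q : (ℤ × ℤ) × Cfg => f q.1.1 q.1.2 q.2 :=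
    measurable_from_prod_countable_right fun q => hf q.1 q.2
  exact h.comp (((measurable_pt k).prodMk (measurable_pt l)).prodMk measurable_id)

/-! ### The law of the configuration -/

/-- The edges are independent and blue with probability `p`, and have the value `0` otherwise. -/
structure BernoulliLaw (P : Measure Cfg) (p : ℝ) : Prop where
  prob : IsProbabilityMeasure P
  pos : 0 < p
  lt_one : p < 1
  indep : iIndepFun coord P
  one : ∀ e, P {c | coord e c = 1} = ENNReal.ofReal p
  zero : ∀ e, P {c | coord e c = 0} = ENNReal.ofReal (1 - p)

namespace BernoulliLaw

variable {P : Measure Cfg} {p : ℝ} (hP : BernoulliLaw P p)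
include hP

theorem prob_inter {E F : Set Cfg} {J K : Set Edge} (hE : MeasurableSet E) (hF : MeasurableSet F)
    (hEJ : DependsOn (· ∈ E) J) (hFK : DependsOn (· ∈ F) K) (hJK : Disjoint J K) :
    P (E ∩ F) = P E * P F := by
  have hind := indep_iSup_of_disjoint (fun e => (measurable_coord e).comap_le)
    ((iIndepFun_iff_iIndep _ _ _).1 hP.indep) hJK
  have key : ∀ {E : Set Cfg} {J : Set Edge}, MeasurableSet E → DependsOn (· ∈ E) J →
      MeasurableSet[⨆ e ∈ J, MeasurableSpace.comap (coord e) inferInstance] E := by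
    intro E J hE hEJ
    classical
    -- Resetting all coordinates outside `J` to `1` is measurable for the σ-algebra of `J`, and `E`
    -- is its own preimage under this map.
    have hm : @Measurable _ _ (⨆ e ∈ J, MeasurableSpace.comap (coord e) inferInstance) _
        (fun (c : Cfg) (e : Edge) => if e ∈ J then c e else 1) := by
      refine @measurable_pi_lambda _ _ _ (_) _ _ fun e => ?_
      by_cases he : e ∈ J
      · simp only [he, if_true]
        exact Measurable.mono (comap_measurable (coord e))
          (le_iSup₂_of_le (f := fun e (_ : e ∈ J) =>
            MeasurableSpace.comap (coord e) inferInstance) e he le_rfl) le_rfl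
      · simp only [he, if_false]
        exact @measurable_const _ _ _ (_) _
    have : E = (fun (c : Cfg) (e : Edge) => if e ∈ J then c e else 1) ⁻¹' E := by
      ext c
      exact iff_of_eq (hEJ fun e he => by simp [he])
    rw [this]
    exact hm hE
  exact (Indep_iff _ _ _).1 hind E F (key hE hEJ) (key hF hFK)

theorem ae_zero_or_one : ∀ᵐ c ∂P, ∀ e, coord e c = 0 ∨ coord e c = 1 := by
  have := hP.prob
  rw [ae_all_iff]
  intro e
  have hd : Disjoint {c | coord e c = 0} {c | coord e c = 1} := by
    rw [Set.disjoint_left]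
    intro c h0 h1
    exact zero_ne_one (h0.symm.trans h1)
  have hm0 : MeasurableSet {c | coord e c = 0} := measurableSet_setOfPred.2 (measurable_coord_eq e 0)
  have hm1 : MeasurableSet {c | coord e c = 1} := measurableSet_setOfPred.2 (measurable_coord_eq e 1)
  have h : P ({c | coord e c = 0} ∪ {c | coord e c = 1}) = 1 := by
    rw [measure_union hd hm1, hP.one, hP.zero, ← ENNReal.ofReal_add (by linarith [hP.lt_one])
      hP.pos.le]
    simp
  exact (prob_compl_eq_zero_iff (hm0.union hm1)).2 h

theorem map_coord (e : Edge) : P.map (coord e)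
    = ENNReal.ofReal p • Measure.dirac 1 + ENNReal.ofReal (1 - p) • Measure.dirac 0 := by
  have hm0 : MeasurableSet {c | coord e c = 0} := measurableSet_setOfPred.2 (measurable_coord_eq e 0)
  have hm1 : MeasurableSet {c | coord e c = 1} := measurableSet_setOfPred.2 (measurable_coord_eq e 1)
  ext A hA
  rw [Measure.map_apply (measurable_coord e) hA]
  have h1 : P (coord e ⁻¹' A)
      = P (coord e ⁻¹' A ∩ {c | coord e c = 1}) + P (coord e ⁻¹' A ∩ {c | coord e c = 0}) := by
    rw [← measure_union _ ((measurable_coord e hA).inter hm0)]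
    · refine measure_congr ?_
      filter_upwards [hP.ae_zero_or_one] with c hc
      refine propext ⟨fun h => ?_, fun h => ?_⟩
      · rcases hc e with h0 | h1
        · exact .inr ⟨h, h0⟩
        · exact .inl ⟨h, h1⟩
      · exact h.elim And.left And.left
    · rw [Set.disjoint_left]
      intro c h1 h0
      exact zero_ne_one (h0.2.symm.trans h1.2)
  have h2 : ∀ r : ℝ, P (coord e ⁻¹' A ∩ {c | coord e c = r})
      = P {c | coord e c = r} * A.indicator 1 r := by
    intro r
    by_cases hr : r ∈ A
    · rw [Set.indicator_of_mem hr, Pi.one_apply, mul_one]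
      congr 1
      refine Set.inter_eq_right.2 fun c hc => ?_
      change coord e c ∈ A
      rwa [show coord e c = r from hc]
    · rw [Set.indicator_of_notMem hr, mul_zero]
      have : coord e ⁻¹' A ∩ {c | coord e c = r} = ∅ :=
        Set.eq_empty_of_forall_notMem fun c hc => hr ((show coord e c = r from hc.2) ▸ hc.1)
      rw [this, measure_empty]
  rw [h1, h2, h2, hP.one, hP.zero]
  simp [hA]

/-- Injective reindexing keeps independence and the common marginal, so both sides are the same
product measure. Covers translations and the reflection. -/
theorem map_comp {f : Edge → Edge} (hf : Function.Injective f) :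
    P.map (fun c : Cfg => c ∘ f) = P := by
  have h1 := (hP.indep.precomp hf).map_fun_eq_infinitePi_map fun e => measurable_coord (f e)
  have h2 := hP.indep.map_fun_eq_infinitePi_map measurable_coord
  simp only [hP.map_coord] at h1 h2
  have h3 : P.map (fun c : Cfg => c ∘ f) = P.map fun c e => coord e c := by
    rw [h2, ← h1]; rfl
  rw [h3]
  exact Measure.map_id

theorem prob_comp_mem {f : Edge → Edge} (hf : Function.Injective f) {E : Set Cfg}
    (hE : MeasurableSet E) : P {c : Cfg | c ∘ f ∈ E} = P E := by
  conv_rhs => rw [← hP.map_comp hf]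
  rw [Measure.map_apply _ hE]
  · rfl
  · exact measurable_pi_lambda _ fun e => measurable_pi_apply (f e)

end BernoulliLaw

/-! ### The rate of skeleton points -/

/-- The probability that a vertex is joined to the next `n` vertices. -/
noncomputable def partialRho (p : ℝ) (n : ℕ) : ℝ := ∏ k ∈ Finset.range n, (1 - (1 - p) ^ (k + 1))

/-- The probability that a vertex is joined to all vertices to its right. -/
noncomputable def rho (p : ℝ) : ℝ := ∏' k : ℕ, (1 - (1 - p) ^ (k + 1))

section Product

variable {p : ℝ} (hp0 : 0 < p) (hp1 : p < 1)
include hp0 hp1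

theorem rho_factor_pos (k : ℕ) : 0 < 1 - (1 - p) ^ (k + 1) :=
  sub_pos.2 (pow_lt_one₀ (by linarith) (by linarith) k.succ_ne_zero)

theorem summable_log_rho_factor : Summable fun k : ℕ => Real.log (1 - (1 - p) ^ (k + 1)) := by
  simp only [sub_eq_add_neg (1 : ℝ)]
  refine Real.summable_log_one_add_of_summable (Summable.neg ?_)
  exact (summable_nat_add_iff 1).2 (summable_geometric_of_lt_one (by linarith) (by linarith))

theorem multipliable_rho : Multipliable fun k : ℕ => 1 - (1 - p) ^ (k + 1) :=
  Real.multipliable_of_summable_log (rho_factor_pos hp0 hp1) (summable_log_rho_factor hp0 hp1)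

theorem rho_pos : 0 < rho p := by
  rw [rho, ← Real.rexp_tsum_eq_tprod (rho_factor_pos hp0 hp1) (summable_log_rho_factor hp0 hp1)]
  exact Real.exp_pos _

theorem multipliable_gamma : Multipliable fun k : ℕ => (1 - (1 - p) ^ (k + 1)) ^ 2 := by
  simp only [sq]
  exact (multipliable_rho hp0 hp1).mul (multipliable_rho hp0 hp1)

theorem gamma_eq : γ p = rho p * rho p := by
  simp only [γ, sq]
  exact (multipliable_rho hp0 hp1).tprod_mul (multipliable_rho hp0 hp1)

theorem gamma_pos : 0 < γ p := by
  rw [gamma_eq hp0 hp1]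
  exact mul_pos (rho_pos hp0 hp1) (rho_pos hp0 hp1)

theorem partialRho_nonneg (n : ℕ) : 0 ≤ partialRho p n :=
  Finset.prod_nonneg fun k _ => (rho_factor_pos hp0 hp1 k).le

theorem tendsto_partialRho : Tendsto (partialRho p) atTop (𝓝 (rho p)) :=
  (multipliable_rho hp0 hp1).hasProd.tendsto_prod_nat

end Product

theorem measurableSet_exists_blue (i j : ℤ) : MeasurableSet {c | ∃ l, i ≤ l ∧ Blue coord c l j} :=
  measurableSet_setOfPred.2 <| Measurable.exists fun l => measurable_const.and (measurable_blue l j)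

theorem blue_congr {c c' : Cfg} {i j : ℤ} (h : ∀ hij : i < j, c ⟨(i, j), hij⟩ = c' ⟨(i, j), hij⟩) :
    Blue coord c i j ↔ Blue coord c' i j :=
  exists_congr fun hij => by simp [coord, h hij]

theorem dependsOn_exists_blue (i j : ℤ) :
    DependsOn (· ∈ {c | ∃ l, i ≤ l ∧ Blue coord c l j}) {e | i ≤ e.1.1 ∧ e.1.2 = j} := by
  intro c c' h
  exact propext <| exists_congr fun l => and_congr_right fun hl =>
    blue_congr fun hlj => h _ ⟨hl, rfl⟩

namespace BernoulliLaw

variable {P : Measure Cfg} {p : ℝ} (hP : BernoulliLaw P p)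
include hP

theorem prob_compl_exists_blue (j : ℤ) (k : ℕ) :
    P {c | ∃ l, j - k ≤ l ∧ Blue coord c l j}ᶜ = ENNReal.ofReal ((1 - p) ^ k) := by
  have := hP.prob
  have hq : 0 ≤ 1 - p := by linarith [hP.lt_one]
  induction k with
  | zero =>
    have : {c | ∃ l, j - (0 : ℕ) ≤ l ∧ Blue coord c l j}ᶜ = Set.univ := by
      refine Set.eq_univ_of_forall fun c => ?_
      rintro ⟨l, hl, hlj, -⟩
      push_cast at hl
      omega
    rw [this, measure_univ]; simp
  | succ k ih =>
    have hlt : j - ((k + 1 : ℕ) : ℤ) < j := by omega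
    -- Passing from `k` to `k + 1` adds one independent edge that must fail to be blue, hence one
    -- more factor `1 - p`.
    have h1 : {c | ∃ l, j - ((k + 1 : ℕ) : ℤ) ≤ l ∧ Blue coord c l j}ᶜ
        = {c | ∃ l, j - (k : ℤ) ≤ l ∧ Blue coord c l j}ᶜ ∩
          {c | coord ⟨(j - ((k + 1 : ℕ) : ℤ), j), hlt⟩ c = 1}ᶜ := by
      ext c
      simp only [Set.mem_compl_iff, Set.mem_ofPred_eq, Set.mem_inter_iff, ← not_or, not_iff_not]
      constructor
      · rintro ⟨l, hl, hb⟩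
        rcases hl.eq_or_lt with rfl | hl
        · exact .inr hb.2
        · exact .inl ⟨l, by push_cast at hl; omega, hb⟩
      · rintro (⟨l, hl, hb⟩ | hb)
        · exact ⟨l, by push_cast; omega, hb⟩
        · exact ⟨_, le_rfl, hlt, hb⟩
    have hm : MeasurableSet {c | coord ⟨(j - ((k + 1 : ℕ) : ℤ), j), hlt⟩ c = 1} :=
      measurableSet_setOfPred.2 (measurable_coord_eq _ 1)
    have hdep : DependsOn (· ∈ {c | coord ⟨(j - ((k + 1 : ℕ) : ℤ), j), hlt⟩ c = 1}ᶜ)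
        {e : Edge | e.1.1 = j - ((k + 1 : ℕ) : ℤ)} := by
      intro c c' h
      simp only [coord, Set.mem_compl_iff, Set.mem_ofPred_eq]
      rw [h _ rfl]
    have hdep' : DependsOn (· ∈ {c | ∃ l, j - (k : ℤ) ≤ l ∧ Blue coord c l j}ᶜ)
        {e : Edge | j - (k : ℤ) ≤ e.1.1 ∧ e.1.2 = j} := by
      intro c c' h
      exact congrArg Not (dependsOn_exists_blue _ _ h)
    rw [h1, hP.prob_inter (measurableSet_exists_blue _ _).compl hm.compl hdep' hdep, ih,
      measure_compl hm (measure_ne_top _ _), hP.one, measure_univ, pow_succ,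
      ENNReal.ofReal_mul (pow_nonneg hq k), ENNReal.ofReal_sub _ hP.pos.le, ENNReal.ofReal_one]
    rw [Set.disjoint_left]
    intro e h1 h2
    have h3 : e.1.1 = j - ((k + 1 : ℕ) : ℤ) := h2
    have h4 := h1.1
    push_cast at h3
    omega

theorem prob_rightTo (i : ℤ) (n : ℕ) :
    P (rightTo i (i + n)) = ENNReal.ofReal (partialRho p n) := by
  have := hP.prob
  induction n with
  | zero =>
    have : rightTo i (i + (0 : ℕ)) = Set.univ := by
      refine Set.eq_univ_of_forall fun c j h1 h2 => ?_
      push_cast at h2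
      omega
    rw [this, measure_univ]; simp [partialRho]
  | succ n ih =>
    -- The new condition only involves the `n + 1` edges from `[i, i + n]` into the new vertex, none
    -- of which lies in `[i, i + n]`.
    have h1 : rightTo i (i + (n + 1 : ℕ)) = rightTo i (i + n) ∩
        {c | ∃ l, i ≤ l ∧ Blue coord c l (i + (n + 1 : ℕ))} := by
      ext c
      simp only [Set.mem_inter_iff, mem_rightTo_iff, Set.mem_ofPred_eq]
      constructor
      · intro h
        exact ⟨fun j h1 h2 => h j h1 (by push_cast; omega), h _ (by omega) le_rfl⟩
      · rintro ⟨h1, h2⟩ j h3 h4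
        rcases h4.eq_or_lt with rfl | h4
        · exact h2
        · exact h1 j h3 (by push_cast at h4; omega)
    have h2 := hP.prob_compl_exists_blue (i + (n + 1 : ℕ)) (n + 1)
    rw [add_sub_cancel_right, prob_compl_eq_one_sub (measurableSet_exists_blue _ _)] at h2
    have h3 : P {c | ∃ l, i ≤ l ∧ Blue coord c l (i + (n + 1 : ℕ))}
        = ENNReal.ofReal (1 - (1 - p) ^ (n + 1)) := by
      rw [ENNReal.ofReal_sub _ (pow_nonneg (by linarith [hP.lt_one]) _), ← h2, ENNReal.ofReal_one,
        ENNReal.sub_sub_cancel ENNReal.one_ne_top prob_le_one]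
    rw [h1, hP.prob_inter (measurableSet_rightTo _ _) (measurableSet_exists_blue _ _)
      (dependsOn_rightTo _ _) (dependsOn_exists_blue _ _), ih, h3,
      ← ENNReal.ofReal_mul (partialRho_nonneg hP.pos hP.lt_one n), partialRho, partialRho,
      Finset.prod_range_succ]
    rw [Set.disjoint_left]
    intro e h1 h2
    have h3 := h1.2
    have h4 : e.1.2 = _ := h2.2
    push_cast at h4
    omega

theorem prob_rightAll (i : ℤ) : P (rightAll i) = ENNReal.ofReal (rho p) := by
  have := hP.prob
  have h1 : rightAll i = ⋂ n : ℕ, rightTo i (i + n) := by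
    ext c
    rw [Set.mem_iInter]
    exact ⟨fun h n j hj _ => h j hj, fun h j hj => h (j - i).toNat j hj (by omega)⟩
  have h2 := tendsto_measure_iInter_atTop (μ := P) (s := fun n : ℕ => rightTo i (i + n))
    (fun n => (measurableSet_rightTo _ _).nullMeasurableSet)
    (fun n m hnm c hc j h1 h2 => hc j h1 (by omega)) ⟨0, measure_ne_top _ _⟩
  rw [← h1] at h2
  refine tendsto_nhds_unique h2 ?_
  refine ((ENNReal.continuous_ofReal.tendsto _).comp
    (tendsto_partialRho hP.pos hP.lt_one)).congr fun n => ?_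
  exact (hP.prob_rightTo i n).symm

theorem prob_leftFrom (i : ℤ) (n : ℕ) :
    P (leftFrom (i - n) i) = ENNReal.ofReal (partialRho p n) := by
  rw [← hP.prob_rightTo (-i) n, ← hP.prob_comp_mem reflectEdge_injective (measurableSet_leftFrom _ _)]
  simp only [leftFrom_reflect]
  rw [neg_sub, sub_eq_neg_add]
  rfl

theorem prob_leftAll (i : ℤ) : P (leftAll i) = ENNReal.ofReal (rho p) := by
  rw [← hP.prob_rightAll (-i), ← hP.prob_comp_mem reflectEdge_injective (measurableSet_leftAll _)]
  congr 1
  ext c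
  constructor
  · intro h j hj
    have := (reaches_reflect c _ _).1 (h (-j) (by omega))
    rwa [neg_neg] at this
  · intro h j hj
    exact (reaches_reflect c _ _).2 (h (-j) (by omega))

/-- Independence of the events on the left of `a`, on `[a, b]`, and on the right of `b`. -/
theorem prob_inter_three {E F G : Set Cfg} {a b : ℤ} (hE : MeasurableSet E)
    (hF : MeasurableSet F) (hG : MeasurableSet G) (hE' : DependsOn (· ∈ E) (edgesLE a))
    (hF' : DependsOn (· ∈ F) (edgesIcc a b)) (hG' : DependsOn (· ∈ G) (edgesGE b))
    (hab : a ≤ b) : P (E ∩ F ∩ G) = P E * P F * P G := by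
  rw [hP.prob_inter (hE.inter hF) hG ((hE'.mono (t := edgesLE b) fun e he => le_trans he hab).mem_inter
    (hF'.mono fun e he => he.2)) hG', hP.prob_inter hE hF hE' hF']
  · rw [Set.disjoint_left]
    intro e h1 h2
    have h3 : e.1.2 ≤ a := h1
    have h4 := h2.1
    have h5 := e.2
    omega
  · rw [Set.disjoint_left]
    intro e h1 h2
    have h3 : e.1.2 ≤ b := h1
    have h4 : b ≤ e.1.1 := h2
    have h5 := e.2
    omega

theorem prob_inter_two {E G : Set Cfg} {a : ℤ} (hE : MeasurableSet E)
    (hG : MeasurableSet G) (hE' : DependsOn (· ∈ E) (edgesLE a))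
    (hG' : DependsOn (· ∈ G) (edgesGE a)) : P (E ∩ G) = P E * P G := by
  have := hP.prob
  have := hP.prob_inter_three hE MeasurableSet.univ hG hE' (fun _ _ _ => rfl) hG' (le_refl a)
  simpa using this

theorem prob_mem_skeleton (i : ℤ) : P {c | i ∈ skeleton coord c} = ENNReal.ofReal (γ p) := by
  simp only [mem_skeleton_iff_mem_inter]
  rw [gamma_eq hP.pos hP.lt_one, ENNReal.ofReal_mul (rho_pos hP.pos hP.lt_one).le]
  refine (hP.prob_inter_two (measurableSet_leftAll i) (measurableSet_rightAll i)
    (dependsOn_leftAll i) (dependsOn_rightAll i)).trans ?_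
  rw [hP.prob_leftAll, hP.prob_rightAll]

/-- Between `i` and `j` only the connections from `i` to its next `m` vertices and to `j` from its
last `m` are kept. The windows have no common edge, so four independent events remain. As `m → ∞`
the bound tends to `γ p ^ 2`. -/
theorem prob_two_mem_skeleton_le {i j : ℤ} {m : ℕ} (hij : i + 2 * m ≤ j) :
    P {c | i ∈ skeleton coord c ∧ j ∈ skeleton coord c}
      ≤ ENNReal.ofReal (γ p * partialRho p m ^ 2) := by
  have hr := (rho_pos hP.pos hP.lt_one).le
  have hm := partialRho_nonneg hP.pos hP.lt_one m
  have hsub : {c | i ∈ skeleton coord c ∧ j ∈ skeleton coord c}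
      ⊆ leftAll i ∩ (rightTo i (i + m) ∩ leftFrom (j - m) j) ∩ rightAll j := by
    intro c hc
    have h1 := mem_skeleton_iff_mem_inter.1 hc.1
    have h2 := mem_skeleton_iff_mem_inter.1 hc.2
    exact ⟨⟨h1.1, fun k hk _ => h1.2 k hk, fun k _ hk => h2.1 k hk⟩, h2.2⟩
  refine (measure_mono hsub).trans (le_of_eq ?_)
  rw [hP.prob_inter_three (measurableSet_leftAll i)
    ((measurableSet_rightTo _ _).inter (measurableSet_leftFrom _ _)) (measurableSet_rightAll j)
    (dependsOn_leftAll i)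
    (((dependsOn_rightTo _ _).mono (t := edgesIcc i j) fun e he => ⟨he.1, he.2.trans (by omega)⟩).mem_inter
      ((dependsOn_leftFrom _ _).mono (t := edgesIcc i j) fun e he => ⟨by have := he.1; omega, he.2⟩))
    (dependsOn_rightAll j) (by omega),
    hP.prob_inter (measurableSet_rightTo _ _) (measurableSet_leftFrom _ _) (dependsOn_rightTo _ _)
      (dependsOn_leftFrom _ _), hP.prob_leftAll, hP.prob_rightTo, hP.prob_leftFrom,
    hP.prob_rightAll, gamma_eq hP.pos hP.lt_one, ← ENNReal.ofReal_mul hm, ← ENNReal.ofReal_mul hr,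
    ← ENNReal.ofReal_mul (by positivity)]
  · congr 1; ring
  · rw [Set.disjoint_left]
    intro e h1 h2
    have h3 := h1.2
    have h4 := h2.1
    have h5 := e.2
    omega

end BernoulliLaw

/-! ### Existence of skeleton points -/

/-- A second moment bound for the probability that none of the events `E i` occurs. -/
theorem sq_mul_measureReal_iInter_compl_le {X : Type*} [MeasurableSpace X] {μ : Measure X}
    [IsProbabilityMeasure μ] {E : ℕ → Set X} (hE : ∀ i, MeasurableSet (E i)) {g κ : ℝ}
    (hg : ∀ i, μ.real (E i) = g) (hκ : ∀ i j, i ≠ j → μ.real (E i ∩ E j) ≤ κ) :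
    g ^ 2 * μ.real (⋂ i, (E i)ᶜ) ≤ κ - g ^ 2 := by
  have hg0 : 0 ≤ g := hg 0 ▸ measureReal_nonneg
  have hg1 : g ≤ 1 := hg 0 ▸ measureReal_le_one
  have hκ0 : 0 ≤ κ := le_trans measureReal_nonneg (hκ 0 1 (by simp))
  set T := ⋂ i, (E i)ᶜ with hT
  have hTm : MeasurableSet T := MeasurableSet.iInter fun i => (hE i).compl
  have hint : ∀ A : Set X, MeasurableSet A → Integrable (fun ω => A.indicator (1 : X → ℝ) ω) μ :=
    fun A hA => (integrable_const (1 : ℝ)).indicator hA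
  -- Second moment of the sum of `n` centred indicators: on `T` its square is `(n * g) ^ 2`, while
  -- the `n` diagonal covariances are bounded by `1 + (κ - g ^ 2)` and the others by `κ - g ^ 2`.
  have key : ∀ n : ℕ, g ^ 2 * μ.real T * n ^ 2 ≤ n + n ^ 2 * (κ - g ^ 2) := by
    intro n
    let a : ℕ → X → ℝ := fun i ω => (E i).indicator 1 ω - g
    have hprod : ∀ i j, (fun ω => a i ω * a j ω) = fun ω => (E i ∩ E j).indicator 1 ω
        - g * (E i).indicator 1 ω - g * (E j).indicator 1 ω + g ^ 2 := by
      intro i j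
      funext ω
      have : (E i ∩ E j).indicator (1 : X → ℝ) ω = (E i).indicator 1 ω * (E j).indicator 1 ω := by
        rw [Set.inter_indicator_one]; rfl
      simp only [a, this]
      ring
    have hi1 := fun i => (hint _ (hE i)).const_mul g
    have hi2 := fun i j => hint _ ((hE i).inter (hE j))
    have haint : ∀ i j, Integrable (fun ω => a i ω * a j ω) μ := by
      intro i j
      rw [hprod]
      exact (((hi2 i j).sub (hi1 i)).sub (hi1 j)).add (integrable_const _)
    have hcov : ∀ i j, ∫ ω, a i ω * a j ω ∂μ = μ.real (E i ∩ E j) - g ^ 2 := by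
      intro i j
      have e1 : Integrable (fun ω => (E i ∩ E j).indicator (1 : X → ℝ) ω
          - g * (E i).indicator 1 ω) μ := (hi2 i j).sub (hi1 i)
      have e2 : Integrable (fun ω => (E i ∩ E j).indicator (1 : X → ℝ) ω
          - g * (E i).indicator 1 ω - g * (E j).indicator 1 ω) μ := e1.sub (hi1 j)
      rw [hprod, integral_add e2 (integrable_const _), integral_sub e1 (hi1 j),
        integral_sub (hi2 i j) (hi1 i),
        integral_const_mul, integral_const_mul, integral_indicator_one ((hE i).inter (hE j)),
        integral_indicator_one (hE i), integral_indicator_one (hE j), hg, hg]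
      simp
      ring
    have h1 : ∫ ω, T.indicator (fun _ => (n * g) ^ 2) ω ∂μ
        ≤ ∫ ω, ∑ i ∈ Finset.range n, ∑ j ∈ Finset.range n, a i ω * a j ω ∂μ := by
      refine integral_mono ((integrable_const _).indicator hTm)
        (integrable_finsetSum _ fun i _ => integrable_finsetSum _ fun j _ => haint i j) fun ω => ?_
      simp only [← Finset.sum_mul_sum]
      by_cases hω : ω ∈ T
      · have : ∀ i, a i ω = -g := by
          intro i
          have : ω ∉ E i := Set.mem_iInter.1 hω i
          simp [a, this]
        simp only [this, Set.indicator_of_mem hω, Finset.sum_const, Finset.card_range,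
          nsmul_eq_mul]
        exact le_of_eq (by ring)
      · rw [Set.indicator_of_notMem hω]
        exact mul_self_nonneg _
    rw [integral_indicator_const _ hTm, integral_finsetSum _ fun i _ =>
      integrable_finsetSum _ fun j _ => haint i j] at h1
    simp only [integral_finsetSum _ fun j _ => haint _ j, hcov] at h1
    have h2 : ∑ i ∈ Finset.range n, ∑ j ∈ Finset.range n, (μ.real (E i ∩ E j) - g ^ 2)
        ≤ ∑ i ∈ Finset.range n, ∑ j ∈ Finset.range n, ((if i = j then 1 else 0) + (κ - g ^ 2)) := by
      refine Finset.sum_le_sum fun i _ => Finset.sum_le_sum fun j _ => ?_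
      split_ifs with hij
      · have : μ.real (E i ∩ E j) ≤ 1 := measureReal_le_one
        linarith
      · linarith [hκ i j hij]
    have h3 : ∑ i ∈ Finset.range n, ∑ j ∈ Finset.range n,
        (((if i = j then 1 else 0) : ℝ) + (κ - g ^ 2)) = n + n ^ 2 * (κ - g ^ 2) := by
      simp only [Finset.sum_add_distrib, Finset.sum_ite_eq, Finset.sum_const, Finset.card_range,
        nsmul_eq_mul]
      rw [Finset.sum_congr rfl fun i hi => if_pos hi]
      simp
      ring
    rw [h3] at h2
    rw [smul_eq_mul] at h1
    calc g ^ 2 * μ.real T * n ^ 2 = μ.real T * (n * g) ^ 2 := by ring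
      _ ≤ _ := h1.trans h2
  refine le_of_forall_pos_le_add fun ε hε => ?_
  -- For `n > 1 / ε` the diagonal contribution `n` in `key` is smaller than `ε * n ^ 2`.
  obtain ⟨n, hn⟩ := exists_nat_gt (1 / ε)
  have hn0 : (0 : ℝ) < n := lt_trans (by positivity) hn
  have h1 : 1 < ε * n := by rwa [div_lt_iff₀' hε] at hn
  have h2 := key n
  by_contra! hcon
  nlinarith [mul_lt_mul_of_pos_right hcon (pow_pos hn0 2)]

namespace BernoulliLaw

variable {P : Measure Cfg} {p : ℝ} (hP : BernoulliLaw P p)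
include hP

/-- For each `m` the second moment bound applies along the sequence `s m`, whose points are at least
`2 * m` apart; its right side vanishes as `m → ∞` because `γ = ρ ^ 2`. The disjunction in `hs`
admits sequences going to either side. -/
theorem prob_iInter_notMem_skeleton {s : ℕ → ℕ → ℤ}
    (hs : ∀ m i j, i < j → s m i + 2 * m ≤ s m j ∨ s m j + 2 * m ≤ s m i) :
    P {c | ∀ m i, s m i ∉ skeleton coord c} = 0 := by
  have := hP.prob
  have hγ := gamma_pos hP.pos hP.lt_one
  have hms : ∀ i, MeasurableSet {c | i ∈ skeleton coord c} := fun i =>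
    measurableSet_setOfPred.2 (measurable_mem_skeleton i)
  have h1 : ∀ m, γ p ^ 2 * P.real {c | ∀ m i, s m i ∉ skeleton coord c}
      ≤ γ p * partialRho p m ^ 2 - γ p ^ 2 := by
    intro m
    have hpair : ∀ i j, i < j → P.real ({c | s m i ∈ skeleton coord c} ∩
        {c | s m j ∈ skeleton coord c}) ≤ γ p * partialRho p m ^ 2 := by
      intro i j hij
      refine ENNReal.toReal_le_of_le_ofReal (by positivity) ?_
      rcases hs m i j hij with h | h
      · exact hP.prob_two_mem_skeleton_le h
      · rw [Set.inter_comm]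
        exact hP.prob_two_mem_skeleton_le h
    refine le_trans ?_ (sq_mul_measureReal_iInter_compl_le (μ := P)
      (E := fun i => {c | s m i ∈ skeleton coord c}) (fun i => hms _) (g := γ p)
      (κ := γ p * partialRho p m ^ 2) (fun i => ?_) fun i j hij => ?_)
    · refine mul_le_mul_of_nonneg_left (measureReal_mono ?_) (by positivity)
      intro c hc
      exact Set.mem_iInter.2 fun i => hc m i
    · rw [measureReal_def, hP.prob_mem_skeleton, ENNReal.toReal_ofReal hγ.le]
    · rcases lt_or_gt_of_ne hij with h | h
      · exact hpair i j h
      · rw [Set.inter_comm]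
        exact hpair j i h
  have h2 : Tendsto (fun m => γ p * partialRho p m ^ 2 - γ p ^ 2) atTop
      (𝓝 (γ p * rho p ^ 2 - γ p ^ 2)) :=
    (((tendsto_partialRho hP.pos hP.lt_one).pow 2).const_mul _).sub_const _
  have h3 := ge_of_tendsto' h2 h1
  have h4 : γ p * rho p ^ 2 - γ p ^ 2 = 0 := by
    rw [gamma_eq hP.pos hP.lt_one]; ring
  rw [h4] at h3
  have h5 : P.real {c | ∀ m i, s m i ∉ skeleton coord c} ≤ 0 := by
    by_contra! h
    exact absurd h3 (not_le.2 (by positivity))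
  exact (measureReal_eq_zero_iff).1 (le_antisymm h5 measureReal_nonneg)

/-- Almost surely the skeleton is unbounded in both directions. -/
theorem ae_unbounded : ∀ᵐ c ∂P, Unbounded (skeleton coord c) := by
  have h1 : ∀ᵐ c ∂P, ∀ a, ∃ s ∈ skeleton coord c, s < a := by
    rw [ae_all_iff]
    intro a
    refine measure_mono_null ?_ (hP.prob_iInter_notMem_skeleton
      (s := fun m i => a - 1 - (2 * m + 1) * i) fun m i j hij => .inr ?_)
    · intro c hc m i hmem
      exact hc ⟨_, hmem, by have : (0 : ℤ) ≤ (2 * m + 1) * i := by positivity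
                            omega⟩
    · have : (i : ℤ) + 1 ≤ j := by exact_mod_cast hij
      nlinarith
  have h2 : ∀ᵐ c ∂P, ∀ a, ∃ s ∈ skeleton coord c, a < s := by
    rw [ae_all_iff]
    intro a
    refine measure_mono_null ?_ (hP.prob_iInter_notMem_skeleton
      (s := fun m i => a + 1 + (2 * m + 1) * i) fun m i j hij => .inl ?_)
    · intro c hc m i hmem
      exact hc ⟨_, hmem, by have : (0 : ℤ) ≤ (2 * m + 1) * i := by positivity
                            omega⟩
    · have : (i : ℤ) + 1 ≤ j := by exact_mod_cast hij
      nlinarith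
  filter_upwards [h1, h2] with c h1 h2 using ⟨h1, h2⟩

end BernoulliLaw

/-! ### Regeneration at skeleton points -/

theorem measure_eq_tsum_fiber {X β : Type*} [MeasurableSpace X] [MeasurableSpace β] [Countable β]
    [MeasurableSingletonClass β] (μ : Measure X) {Z : X → β} (hZ : Measurable Z) {F : Set X}
    (hF : MeasurableSet F) : μ F = ∑' b, μ (F ∩ Z ⁻¹' {b}) := by
  rw [← measure_iUnion]
  · congr 1
    ext ω
    simp
  · intro b b' hbb'
    rw [Function.onFun, Set.disjoint_left]
    rintro ω ⟨_, h1⟩ ⟨_, h2⟩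
    exact hbb' ((show Z ω = b from h1).symm.trans h2)
  · exact fun b => hF.inter (hZ (measurableSet_singleton b))

/-- A real function of the edges in `[i, j]`, covariant under translation. -/
structure IsCycleFunctional (g : ℤ → ℤ → Cfg → ℝ) : Prop where
  measurable : ∀ i j, Measurable (g i j)
  congr : ∀ i j c c', (∀ e ∈ edgesIcc i j, c e = c' e) → g i j c = g i j c'
  shift : ∀ c a i j, g i j (c ∘ shiftEdge a) = g (i + a) (j + a) c

theorem isCycleFunctional_W (x : EReal) :
    IsCycleFunctional fun i j c => (W coord x i j c).toReal where
  measurable i j := (measurable_W x i j).ereal_toReal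
  congr i j c c' h := by rw [W_congr x h]
  shift c a i j := by rw [W_shift]

theorem isCycleFunctional_length : IsCycleFunctional fun i j _ => (j - i : ℝ) where
  measurable i j := measurable_const
  congr i j c c' h := rfl
  shift c a i j := by push_cast; ring

/-- The distribution of `g` over a cycle. -/
noncomputable def cycleLaw (P : Measure Cfg) (g : ℤ → ℤ → Cfg → ℝ) : Measure ℝ :=
  Measure.sum fun n : ℕ => (P.restrict (cycle 0 (n + 1 : ℕ))).map (g 0 (n + 1 : ℕ))

/-- The value of `g` between the `k`-th and the next skeleton point. -/
noncomputable def cycleValue (g : ℤ → ℤ → Cfg → ℝ) (k : ℕ) (c : Cfg) : ℝ :=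
  g (pt k c) (pt (k + 1) c) c

theorem IsCycleFunctional.measurable_cycleValue {g : ℤ → ℤ → Cfg → ℝ} (hg : IsCycleFunctional g)
    (k : ℕ) : Measurable (cycleValue g k) :=
  measurable_comp_pt hg.measurable k (k + 1)

theorem measurable_trunc (a : ℤ) : Measurable (trunc a) := by
  refine measurable_pi_lambda _ fun e => ?_
  by_cases h : e.1.2 ≤ a
  · simp only [trunc, h, if_true]
    exact measurable_pi_apply e
  · simp only [trunc, h, if_false]
    exact measurable_const

/-- On the event that `a` is the `l`-th skeleton point, `E` is determined by the edges in
`(-∞, a]`. -/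
def IsPast (l : ℕ) (E : Set Cfg) : Prop :=
  ∀ a, ∃ E' ⊆ leftAll a, MeasurableSet E' ∧ DependsOn (· ∈ E') (edgesLE a) ∧
    ∀ c, Unbounded (skeleton coord c) → (pt l c = a ∧ c ∈ E ↔ c ∈ E' ∩ rightAll a)

/-- Evaluating the event on `trunc a c` makes it a function of the edges in `(-∞, a]`, and
truncation at the skeleton point `a` changes neither the index of `a` nor, by `h`, membership in
`E`. -/
theorem isPast_of_trunc {l : ℕ} (hl : 1 ≤ l) {E : Set Cfg} (hE : MeasurableSet E)
    (h : ∀ c, Unbounded (skeleton coord c) → (c ∈ E ↔ trunc (pt l c) c ∈ E)) : IsPast l E := by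
  intro a
  by_cases ha : 0 < a
  · refine ⟨leftAll a ∩ trunc a ⁻¹' (pt l ⁻¹' {a} ∩ E), Set.inter_subset_left,
      (measurableSet_leftAll a).inter (measurable_trunc a
        ((measurable_pt l (measurableSet_singleton a)).inter hE)),
      (dependsOn_leftAll a).mem_inter (dependsOn_trunc_preimage a _), fun c hc => ?_⟩
    constructor
    · rintro ⟨rfl, hcE⟩
      have hmem : pt l c ∈ skeleton coord c := enum_mem hc l
      have h1 := mem_skeleton_iff_mem_inter.1 hmem
      exact ⟨⟨h1.1, enum_trunc_eq ha.le hmem hc.2 le_rfl, (h c hc).1 hcE⟩, h1.2⟩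
    · rintro ⟨⟨h1, h2, h3⟩, h4⟩
      have hmem : a ∈ skeleton coord c := mem_skeleton_iff_mem_inter.2 ⟨h1, h4⟩
      have h2' : pt l (trunc a c) = a := h2
      have h5 : pt l c = a := by
        rw [← h2']
        exact (enum_trunc_eq' ha.le hmem hc.2 (le_of_eq h2')).symm
      refine ⟨h5, (h c hc).2 ?_⟩
      rwa [h5]
  -- For `l ≥ 1` the `l`-th point is positive, so nothing happens at `a ≤ 0`.
  · refine ⟨∅, Set.empty_subset _, MeasurableSet.empty, fun _ _ _ => rfl, fun c hc => ?_⟩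
    refine ⟨?_, fun h => absurd h.1 (Set.notMem_empty _)⟩
    rintro ⟨rfl, -⟩
    have h1 : 0 < pt 1 c := enum_one_pos hc
    exact absurd (h1.trans_le ((enum_strictMono hc.2).monotone hl)) ha

theorem isPast_univ {l : ℕ} (hl : 1 ≤ l) : IsPast l Set.univ :=
  isPast_of_trunc hl MeasurableSet.univ fun _ _ => Iff.rfl

theorem isPast_cycleValue {g : ℤ → ℤ → Cfg → ℝ} (hg : IsCycleFunctional g) {k l : ℕ} (hkl : k < l)
    {A : Set ℝ} (hA : MeasurableSet A) : IsPast l (cycleValue g k ⁻¹' A) := by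
  refine isPast_of_trunc (by omega) (hg.measurable_cycleValue k hA) fun c hc => ?_
  have hm : StrictMono fun k => pt k c := enum_strictMono hc.2
  have h0 : 0 ≤ pt l c := by
    have h1 : 0 < pt 1 c := enum_one_pos hc
    exact h1.le.trans (hm.monotone (by omega))
  have h1 : ∀ k, k ≤ l → pt k (trunc (pt l c) c) = pt k c := fun k hk =>
    enum_trunc_eq h0 (enum_mem hc l) hc.2 (hm.monotone hk)
  have h2 : cycleValue g k (trunc (pt l c) c) = cycleValue g k c := by
    rw [cycleValue, cycleValue, h1 k hkl.le, h1 (k + 1) hkl]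
    exact hg.congr _ _ _ _ fun e he => trunc_apply (he.2.trans (hm.monotone hkl))
  rw [Set.mem_preimage, Set.mem_preimage, h2]

/-- For `a < 0`, `pt 0 c = a` also says that no skeleton point lies in `(a, 0]`, which looks into
the future of `a`. Conditioning on `pt 0 c = 0` removes this bias. -/
theorem isPast_pt_zero : IsPast 0 {c | pt 0 c = 0} := by
  intro a
  by_cases ha : a = 0
  · subst ha
    refine ⟨leftAll 0, subset_rfl, measurableSet_leftAll 0, dependsOn_leftAll 0, fun c hc => ?_⟩
    rw [← mem_skeleton_iff_mem_inter]
    constructor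
    · rintro ⟨h, -⟩
      rw [← h]
      exact enum_mem hc 0
    · intro h
      have := enum_zero_of_zero_mem h
      exact ⟨this, this⟩
  · refine ⟨∅, Set.empty_subset _, MeasurableSet.empty, fun _ _ _ => rfl, fun c hc => ?_⟩
    refine ⟨?_, fun h => absurd h.1 (Set.notMem_empty _)⟩
    rintro ⟨rfl, h⟩
    exact absurd h ha

theorem cycleLaw_apply {P : Measure Cfg} {g : ℤ → ℤ → Cfg → ℝ} (hg : IsCycleFunctional g) {A : Set ℝ}
    (hA : MeasurableSet A) : cycleLaw P g A
      = ∑' n : ℕ, P (cycle 0 (n + 1 : ℕ) ∩ g 0 (n + 1 : ℕ) ⁻¹' A) := by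
  rw [cycleLaw, Measure.sum_apply _ hA]
  refine tsum_congr fun n => ?_
  rw [Measure.map_apply (hg.measurable _ _) hA, Measure.restrict_apply (hg.measurable _ _ hA),
    Set.inter_comm]

namespace BernoulliLaw

variable {P : Measure Cfg} {p : ℝ} (hP : BernoulliLaw P p)
include hP

theorem prob_cycle_inter {g : ℤ → ℤ → Cfg → ℝ} (hg : IsCycleFunctional g) (a n : ℤ) {A : Set ℝ}
    (hA : MeasurableSet A) :
    P (cycle a (a + n) ∩ g a (a + n) ⁻¹' A) = P (cycle 0 n ∩ g 0 n ⁻¹' A) := by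
  rw [← hP.prob_comp_mem (shiftEdge_injective a)
    ((measurableSet_cycle 0 n).inter (hg.measurable 0 n hA))]
  congr 1
  ext c
  simp only [Set.mem_ofPred_eq, Set.mem_inter_iff, Set.mem_preimage, cycle_shift, hg.shift,
    zero_add, add_comm n a]

/-- The cycle after a skeleton point is independent of the past. -/
theorem prob_inter_cycleValue {g : ℤ → ℤ → Cfg → ℝ} (hg : IsCycleFunctional g) {l : ℕ}
    {E : Set Cfg} (hE : MeasurableSet E) (hpast : IsPast l E) {A : Set ℝ} (hA : MeasurableSet A) :
    P (E ∩ cycleValue g l ⁻¹' A) = P E * cycleLaw P g A := by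
  choose E' hE'sub hE'm hE'dep hE' using hpast
  have hgap : Measurable fun c => (pt (l + 1) c - pt l c - 1).toNat :=
    (measurable_of_countable Int.toNat).comp
      (((measurable_pt (l + 1)).sub (measurable_pt l)).sub measurable_const)
  -- The event is decomposed by the position `a` of the `l`-th point and the gap `n + 1`;
  -- subtracting `1` lets `n` run over all of `ℕ`.
  have hZ : Measurable fun c => (pt l c, (pt (l + 1) c - pt l c - 1).toNat) :=
    (measurable_pt l).prodMk hgap
  have hterm : ∀ (a : ℤ) (n : ℕ), P ((E ∩ cycleValue g l ⁻¹' A) ∩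
      (fun c => (pt l c, (pt (l + 1) c - pt l c - 1).toNat)) ⁻¹' {(a, n)})
      = P (E' a) * P (cycle 0 (n + 1 : ℕ) ∩ g 0 (n + 1 : ℕ) ⁻¹' A) * ENNReal.ofReal (rho p) := by
    intro a n
    have hlt : a < a + (n + 1 : ℕ) := by omega
    have h1 : P ((E ∩ cycleValue g l ⁻¹' A) ∩
      (fun c => (pt l c, (pt (l + 1) c - pt l c - 1).toNat)) ⁻¹' {(a, n)})
        = P (E' a ∩ (cycle a (a + (n + 1 : ℕ)) ∩ g a (a + (n + 1 : ℕ)) ⁻¹' A) ∩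
          rightAll (a + (n + 1 : ℕ))) := by
      refine measure_congr ?_
      filter_upwards [hP.ae_unbounded] with c hc
      have hm : pt l c < pt (l + 1) c := enum_strictMono hc.2 (Nat.lt_succ_self l)
      refine propext ⟨?_, ?_⟩
      · rintro ⟨⟨h1, h2⟩, h3⟩
        have h4 := Prod.ext_iff.1 (Set.mem_singleton_iff.1 h3)
        simp only at h4
        have h5 : pt (l + 1) c = a + (n + 1 : ℕ) := by push_cast; omega
        have h6 : Consecutive (skeleton coord c) (pt l c) (pt (l + 1) c) := consecutive_enum hc l
        have h7 := (hE' a c hc).1 ⟨h4.1, h1⟩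
        rw [Set.mem_preimage, cycleValue, h5, h4.1] at h2
        rw [h5, h4.1, consecutive_skeleton_iff hlt] at h6
        exact ⟨⟨h7.1, h6.1.2, h2⟩, h6.2⟩
      · rintro ⟨⟨h1, h2, h3⟩, h4⟩
        have h5 : Consecutive (skeleton coord c) a (a + (n + 1 : ℕ)) :=
          (consecutive_skeleton_iff hlt).2 ⟨⟨hE'sub a h1, h2⟩, h4⟩
        have h6 := (hE' a c hc).2 ⟨h1, (mem_skeleton_iff_mem_inter.1 h5.1).2⟩
        have h7 : enum (skeleton coord c) l = a := h6.1
        have h8 : pt (l + 1) c = a + (n + 1 : ℕ) :=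
          enum_succ_of_consecutive hc.2 (by rw [h7]; exact hlt) (by rw [h7]; exact h5)
        refine ⟨⟨h6.2, ?_⟩, ?_⟩
        · rw [Set.mem_preimage, cycleValue, h6.1, h8]
          exact h3
        · rw [Set.mem_preimage, Set.mem_singleton_iff, h6.1, h8]
          refine Prod.ext rfl ?_
          simp only
          omega
    have hdep : DependsOn (· ∈ cycle a (a + (n + 1 : ℕ)) ∩ g a (a + (n + 1 : ℕ)) ⁻¹' A)
        (edgesIcc a (a + (n + 1 : ℕ))) := by
      refine (dependsOn_cycle _ _).mem_inter fun c c' h => ?_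
      simp only [Set.mem_preimage]
      rw [hg.congr _ _ _ _ h]
    rw [h1, hP.prob_inter_three (hE'm a)
      ((measurableSet_cycle _ _).inter (hg.measurable _ _ hA)) (measurableSet_rightAll _)
      (hE'dep a) hdep (dependsOn_rightAll _) hlt.le, hP.prob_cycle_inter hg a _ hA,
      hP.prob_rightAll]
  -- Here `rho p` is the probability of `rightAll a`; in `hterm` the same factor came from the right
  -- end of the cycle. So the sum over `a` rebuilds `P E`.
  have hsum : P E = ∑' a, P (E' a) * ENNReal.ofReal (rho p) := by
    rw [measure_eq_tsum_fiber P (measurable_pt l) hE]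
    refine tsum_congr fun a => ?_
    rw [← hP.prob_rightAll a, ← hP.prob_inter_two (hE'm a) (measurableSet_rightAll a) (hE'dep a)
      (dependsOn_rightAll a)]
    refine measure_congr ?_
    filter_upwards [hP.ae_unbounded] with c hc
    refine propext (Iff.trans ?_ (hE' a c hc))
    exact and_comm
  rw [measure_eq_tsum_fiber P hZ (hE.inter (hg.measurable_cycleValue l hA)), ENNReal.tsum_prod']
  simp only [hterm]
  rw [hsum, ← ENNReal.tsum_mul_right, cycleLaw_apply hg hA]
  refine tsum_congr fun a => ?_
  rw [ENNReal.tsum_mul_right, ENNReal.tsum_mul_left]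
  ring

theorem prob_pt_zero : P {c | pt 0 c = 0} = ENNReal.ofReal (γ p) := by
  rw [← hP.prob_mem_skeleton 0]
  refine measure_congr ?_
  filter_upwards [hP.ae_unbounded] with c hc
  refine propext ⟨fun h => ?_, fun h => enum_zero_of_zero_mem h⟩
  have h1 : pt 0 c = 0 := h
  have h2 : pt 0 c ∈ skeleton coord c := enum_mem hc 0
  rwa [h1] at h2

/-- The trivial past `Set.univ` suffices; as a by-product `cycleLaw P g` has total mass `1`. -/
theorem map_cycleValue {g : ℤ → ℤ → Cfg → ℝ} (hg : IsCycleFunctional g) {l : ℕ} (hl : 1 ≤ l) :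
    P.map (cycleValue g l) = cycleLaw P g := by
  have := hP.prob
  ext A hA
  rw [Measure.map_apply (hg.measurable_cycleValue l) hA]
  have := hP.prob_inter_cycleValue hg MeasurableSet.univ (isPast_univ hl) hA
  rwa [Set.univ_inter, measure_univ, one_mul] at this

theorem map_cond_cycleValue {g : ℤ → ℤ → Cfg → ℝ} (hg : IsCycleFunctional g) :
    (P[|{c | pt 0 c = 0}]).map (cycleValue g 0) = cycleLaw P g := by
  have hm : MeasurableSet {c | pt 0 c = 0} := measurable_pt 0 (measurableSet_singleton 0)
  have h3 : ENNReal.ofReal (γ p) ≠ 0 := by simpa using gamma_pos hP.pos hP.lt_one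
  ext A hA
  rw [Measure.map_apply (hg.measurable_cycleValue 0) hA, cond_apply hm,
    hP.prob_inter_cycleValue hg hm isPast_pt_zero hA, hP.prob_pt_zero, ← mul_assoc,
    ENNReal.inv_mul_cancel h3 ENNReal.ofReal_ne_top, one_mul]

/-- Pairwise independence is enough for `strong_law_ae_real`. -/
theorem indepFun_cycleValue {g : ℤ → ℤ → Cfg → ℝ} (hg : IsCycleFunctional g) {k l : ℕ}
    (hkl : k < l) : cycleValue g k ⟂ᵢ[P] cycleValue g l := by
  rw [indepFun_iff_measure_inter_preimage_eq_mul]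
  intro s t hs ht
  rw [hP.prob_inter_cycleValue hg (hg.measurable_cycleValue k hs) (isPast_cycleValue hg hkl hs) ht,
    ← hP.map_cycleValue hg (l := l) (by omega), Measure.map_apply (hg.measurable_cycleValue l) ht]

/-- The strong law of large numbers for cycles. -/
theorem ae_tendsto_cycleValue {g : ℤ → ℤ → Cfg → ℝ} (hg : IsCycleFunctional g)
    (hint : Integrable id (cycleLaw P g)) :
    ∀ᵐ c ∂P, Tendsto (fun n : ℕ => (∑ k ∈ Finset.range n, cycleValue g (k + 1) c) / n) atTop
      (𝓝 (∫ r, r ∂cycleLaw P g)) := by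
  have hm := hg.measurable_cycleValue
  have h1 := strong_law_ae_real (μ := P) (fun k => cycleValue g (k + 1)) ?_ ?_ ?_
  · rw [← hP.map_cycleValue hg le_rfl, integral_map (hm 1).aemeasurable (by fun_prop)]
    exact h1
  · rw [← hP.map_cycleValue hg le_rfl] at hint
    exact (integrable_map_measure (by fun_prop) (hm 1).aemeasurable).1 hint
  · intro k l hkl
    rcases lt_or_gt_of_ne hkl with h | h
    · exact hP.indepFun_cycleValue hg (by omega)
    · exact (hP.indepFun_cycleValue hg (by omega)).symm
  · intro k
    refine ⟨(hm _).aemeasurable, (hm _).aemeasurable, ?_⟩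
    rw [hP.map_cycleValue hg (by omega), hP.map_cycleValue hg (by omega)]

end BernoulliLaw

/-! ### The mean cycle length -/

/-- Counts the `n + 1` positions in which a cycle of length `n + 1` covers `0`. -/
theorem tsum_add_eq_tsum_succ_mul (f : ℕ → ENNReal) :
    ∑' ij : ℕ × ℕ, f (ij.1 + ij.2) = ∑' n : ℕ, (n + 1 : ℕ) * f n := by
  rw [← Finset.HasAntidiagonal.sigmaAntidiagonalEquivProd.tsum_eq, ENNReal.tsum_sigma']
  refine tsum_congr fun n => ?_
  have : ∀ x : Finset.HasAntidiagonal.antidiagonal n,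
      f ((Finset.HasAntidiagonal.sigmaAntidiagonalEquivProd ⟨n, x⟩).1
        + (Finset.HasAntidiagonal.sigmaAntidiagonalEquivProd ⟨n, x⟩).2) = f n := fun x => by
    exact congrArg f (Finset.HasAntidiagonal.mem_antidiagonal.1 x.2)
  rw [tsum_congr this, tsum_fintype]
  simp

/-- The law of the cycle length. -/
noncomputable abbrev lengthLaw (P : Measure Cfg) : Measure ℝ :=
  cycleLaw P fun i j _ => (j - i : ℝ)

/-- The law of the maximal weight over a cycle. -/
noncomputable abbrev weightLaw (P : Measure Cfg) (x : EReal) : Measure ℝ :=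
  cycleLaw P fun i j c => (W coord x i j c).toReal

theorem lintegral_lengthLaw (P : Measure Cfg) : ∫⁻ r, ENNReal.ofReal r ∂lengthLaw P
    = ∑' n : ℕ, (n + 1 : ℕ) * P (cycle 0 (n + 1 : ℕ)) := by
  rw [lengthLaw, cycleLaw, lintegral_sum_measure]
  refine tsum_congr fun n => ?_
  rw [lintegral_map ENNReal.measurable_ofReal measurable_const, lintegral_const,
    Measure.restrict_apply_univ]
  congr 1
  have : (((n + 1 : ℕ) : ℤ) : ℝ) - ((0 : ℤ) : ℝ) = ((n + 1 : ℕ) : ℝ) := by push_cast; ring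
  rw [this, ENNReal.ofReal_natCast]

namespace BernoulliLaw

variable {P : Measure Cfg} {p : ℝ} (hP : BernoulliLaw P p)
include hP

/-- Almost surely exactly one cycle `[-i, j + 1]` has `-i ≤ 0 < j + 1`, and each candidate has
probability `ρ * P (cycle 0 (i + j + 1)) * ρ`. Adding up to total mass `1` and grouping by length
gives the mean, including its finiteness. -/
theorem gamma_mul_lintegral_lengthLaw :
    ENNReal.ofReal (γ p) * ∫⁻ r, ENNReal.ofReal r ∂lengthLaw P = 1 := by
  have := hP.prob
  have hr := (rho_pos hP.pos hP.lt_one).le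
  have hZ : Measurable fun c => ((-pt 0 c).toNat, (pt 1 c - 1).toNat) :=
    ((measurable_of_countable Int.toNat).comp (measurable_pt 0).neg).prodMk
      ((measurable_of_countable Int.toNat).comp ((measurable_pt 1).sub measurable_const))
  have hterm : ∀ ij : ℕ × ℕ, P (Set.univ ∩
      (fun c => ((-pt 0 c).toNat, (pt 1 c - 1).toNat)) ⁻¹' {ij})
      = ENNReal.ofReal (γ p) * P (cycle 0 (ij.1 + ij.2 + 1 : ℕ)) := by
    rintro ⟨i, j⟩
    have hlt : -(i : ℤ) < -(i : ℤ) + (i + j + 1 : ℕ) := by omega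
    have h1 : P (Set.univ ∩ (fun c => ((-pt 0 c).toNat, (pt 1 c - 1).toNat)) ⁻¹' {(i, j)})
        = P (leftAll (-i) ∩ cycle (-i) (-i + (i + j + 1 : ℕ)) ∩
          rightAll (-i + (i + j + 1 : ℕ))) := by
      refine measure_congr ?_
      filter_upwards [hP.ae_unbounded] with c hc
      have h0 : pt 0 c ≤ 0 := (isGreatest_enum_zero hc.1).1.2
      have h1 : 0 < pt 1 c := enum_one_pos hc
      refine propext (Iff.trans ?_ (consecutive_skeleton_iff hlt))
      constructor
      · rintro ⟨-, h⟩
        have h4 := Prod.ext_iff.1 (Set.mem_singleton_iff.1 h)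
        simp only at h4
        have h5 : Consecutive (skeleton coord c) (pt 0 c) (pt 1 c) := consecutive_enum hc 0
        have h6 : pt 0 c = -i := by omega
        have h7 : pt 1 c = -i + (i + j + 1 : ℕ) := by push_cast; omega
        rwa [h6, h7] at h5
      · intro h
        have h6 : pt 0 c = -i := enum_zero_of_consecutive hc.1 (by omega) (by push_cast; omega) h
        have h6' : enum (skeleton coord c) 0 = -i := h6
        have h7 : pt 1 c = -i + (i + j + 1 : ℕ) :=
          enum_succ_of_consecutive hc.2 (by rw [h6']; exact hlt) (by rw [h6']; exact h)
        refine ⟨trivial, ?_⟩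
        rw [Set.mem_preimage, Set.mem_singleton_iff, h6, h7]
        refine Prod.ext ?_ ?_
        · simp only; omega
        · simp only; push_cast; omega
    have h2 := hP.prob_cycle_inter isCycleFunctional_length (-i) (i + j + 1 : ℕ) MeasurableSet.univ
    simp only [Set.preimage_univ, Set.inter_univ] at h2
    rw [h1, hP.prob_inter_three (measurableSet_leftAll _) (measurableSet_cycle _ _)
      (measurableSet_rightAll _) (dependsOn_leftAll _) (dependsOn_cycle _ _) (dependsOn_rightAll _)
      hlt.le, hP.prob_leftAll, hP.prob_rightAll, h2, gamma_eq hP.pos hP.lt_one,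
      ENNReal.ofReal_mul hr]
    ring
  have h1 := measure_eq_tsum_fiber P hZ MeasurableSet.univ
  simp only [hterm] at h1
  rw [measure_univ, ENNReal.tsum_mul_left,
    tsum_add_eq_tsum_succ_mul fun n => P (cycle 0 (n + 1 : ℕ))] at h1
  rw [lintegral_lengthLaw, ← h1]

theorem ae_lengthLaw_nonneg : ∀ᵐ r ∂lengthLaw P, 0 ≤ r := by
  rw [lengthLaw, ← hP.map_cycleValue isCycleFunctional_length le_rfl,
    ae_map_iff (isCycleFunctional_length.measurable_cycleValue 1).aemeasurable measurableSet_Ici]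
  filter_upwards [hP.ae_unbounded] with c hc
  have h : pt 1 c < pt 2 c := enum_strictMono hc.2 (Nat.lt_succ_self 1)
  have : (pt 1 c : ℝ) ≤ pt 2 c := by exact_mod_cast h.le
  exact sub_nonneg.2 this

theorem integrable_lengthLaw : Integrable id (lengthLaw P) := by
  refine ⟨measurable_id.aestronglyMeasurable, ?_⟩
  have h1 := hP.gamma_mul_lintegral_lengthLaw
  have h2 : ∫⁻ r, ENNReal.ofReal r ∂lengthLaw P ≠ ⊤ := by
    intro h
    have h3 : ENNReal.ofReal (γ p) ≠ 0 := by simpa using gamma_pos hP.pos hP.lt_one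
    rw [h, ENNReal.mul_top h3] at h1
    exact ENNReal.top_ne_one h1
  rw [HasFiniteIntegral]
  refine lt_of_eq_of_lt (lintegral_congr_ae ?_) h2.lt_top
  filter_upwards [hP.ae_lengthLaw_nonneg] with r hr
  exact Real.enorm_of_nonneg hr

theorem integral_lengthLaw : ∫ r, r ∂lengthLaw P = (γ p)⁻¹ := by
  have h1 := congrArg ENNReal.toReal hP.gamma_mul_lintegral_lengthLaw
  rw [ENNReal.toReal_mul, ENNReal.toReal_ofReal (gamma_pos hP.pos hP.lt_one).le,
    ENNReal.toReal_one, ← integral_eq_lintegral_of_nonneg_ae hP.ae_lengthLaw_nonneg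
      measurable_id.aestronglyMeasurable] at h1
  exact eq_inv_of_mul_eq_one_right h1

end BernoulliLaw

/-! ### Weights over cycles -/

section Weights

variable {c : Cfg} {x : EReal}

theorem reaches_of_mem_skeleton_left {s j : ℤ} (hs : s ∈ skeleton coord c) (hj : j ≤ s) :
    Reaches coord c j s := by
  rcases hj.eq_or_lt with rfl | hj
  · exact reaches_refl _ _ _
  · exact (mem_skeleton_iff.1 hs).1 j hj

theorem reaches_of_mem_skeleton_right {s j : ℤ} (hs : s ∈ skeleton coord c) (hj : s ≤ j) :
    Reaches coord c s j := by
  rcases hj.eq_or_lt with rfl | hj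
  · exact reaches_refl _ _ _
  · exact (mem_skeleton_iff.1 hs).2 j hj

/-- A blue path excludes the value `⊥` even for `x = ⊥`, so between skeleton points real arithmetic
is legitimate. -/
theorem coe_toReal_W (hx : x < 2) (h01 : ∀ e, coord e c = 0 ∨ coord e c = 1) {i j : ℤ}
    (h : Reaches coord c i j) : (((W coord x i j c).toReal : ℝ) : EReal) = W coord x i j c := by
  refine EReal.coe_toReal ?_ ?_
  · exact ((W_le_two_mul hx h01 i j).trans_lt (EReal.coe_lt_top _)).ne
  · exact (lt_of_lt_of_le (EReal.bot_lt_coe 0) h.W_nonneg).ne'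

theorem toReal_W_mem (hx : x < 2) (h01 : ∀ e, coord e c = 0 ∨ coord e c = 1) {i j : ℤ}
    (h : Reaches coord c i j) :
    0 ≤ (W coord x i j c).toReal ∧ (W coord x i j c).toReal ≤ 2 * (j - i) := by
  constructor
  · exact EReal.toReal_nonneg h.W_nonneg
  · have := W_le_two_mul hx h01 i j
    rw [← coe_toReal_W hx h01 h] at this
    exact_mod_cast this

/-- The maximal weight over the `k`-th cycle. -/
noncomputable abbrev cycleWeight (x : EReal) : ℕ → Cfg → ℝ :=
  cycleValue fun i j c => (W coord x i j c).toReal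

theorem coe_cycleWeight (hx : x < 2) (h01 : ∀ e, coord e c = 0 ∨ coord e c = 1)
    (hc : Unbounded (skeleton coord c)) (k : ℕ) :
    ((cycleWeight x k c : ℝ) : EReal) = W coord x (pt k c) (pt (k + 1) c) c :=
  coe_toReal_W hx h01 (reaches_of_mem_skeleton_right (enum_mem hc k)
    (enum_strictMono hc.2 k.lt_succ_self).le)

theorem sum_cycleWeight_le (hx : x < 2) (h01 : ∀ e, coord e c = 0 ∨ coord e c = 1)
    (hc : Unbounded (skeleton coord c)) (n : ℕ) :
    ((∑ k ∈ Finset.range n, cycleWeight x (k + 1) c : ℝ) : EReal)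
      ≤ W coord x (pt 1 c) (pt (n + 1) c) c := by
  induction n with
  | zero => simpa using W_self_nonneg x c (pt 1 c)
  | succ n ih =>
    rw [Finset.sum_range_succ, EReal.coe_add, coe_cycleWeight hx h01 hc]
    exact (add_le_add ih le_rfl).trans (W_add_le x c _ _ _)

/-- The half of additivity that needs the splitting at skeleton points. It starts from `pt 0 c ≤ 0`,
and `sum_cycleWeight_le` from `pt 1 c > 0`, so that together they enclose the weight from `0`. -/
theorem le_sum_cycleWeight (hx : x < 2) (h01 : ∀ e, coord e c = 0 ∨ coord e c = 1)
    (hc : Unbounded (skeleton coord c)) (n : ℕ) :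
    W coord x (pt 0 c) (pt n c) c ≤ ((∑ k ∈ Finset.range n, cycleWeight x k c : ℝ) : EReal) := by
  have hm : StrictMono fun k => pt k c := enum_strictMono hc.2
  induction n with
  | zero => simpa using W_le_two_mul hx h01 (pt 0 c) (pt 0 c)
  | succ n ih =>
    rw [Finset.sum_range_succ, EReal.coe_add, coe_cycleWeight hx h01 hc]
    exact (W_le_add_of_mem_skeleton hx h01 (enum_mem hc n) (hm.monotone n.zero_le)
      (hm.monotone n.le_succ)).trans (add_le_add ih le_rfl)

end Weights

namespace BernoulliLaw

variable {P : Measure Cfg} {p : ℝ} (hP : BernoulliLaw P p)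
include hP

/-- The weight of a cycle lies between `0` and twice its length. -/
theorem integrable_weightLaw {x : EReal} (hx : x < 2) : Integrable id (weightLaw P x) := by
  have hW := isCycleFunctional_W x
  have hL := isCycleFunctional_length
  have h1 := hP.integrable_lengthLaw
  rw [lengthLaw, ← hP.map_cycleValue hL le_rfl,
    integrable_map_measure (by fun_prop) (hL.measurable_cycleValue 1).aemeasurable] at h1
  rw [weightLaw, ← hP.map_cycleValue hW le_rfl,
    integrable_map_measure (by fun_prop) (hW.measurable_cycleValue 1).aemeasurable]
  refine (h1.const_mul 2).mono' (hW.measurable_cycleValue 1).aestronglyMeasurable ?_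
  filter_upwards [hP.ae_unbounded, hP.ae_zero_or_one] with c hc h01
  have h2 := toReal_W_mem hx h01 (reaches_of_mem_skeleton_right (enum_mem hc 1)
    (enum_strictMono hc.2 (Nat.lt_succ_self 1)).le)
  exact (Real.norm_of_nonneg h2.1).trans_le h2.2

/-- `cycleLaw` is by definition a sum of measures over the cycle length, so integrating against it
yields the series. -/
theorem hasSum_weightLaw {x : EReal} (hx : x < 2) :
    HasSum (fun n : ℕ => mean (W coord x 0 (n + 1 : ℕ)) (P.restrict (eventH coord (n + 1))))
      (∫ r, r ∂weightLaw P x) := by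
  have h1 := hasSum_integral_measure (hP.integrable_weightLaw hx)
  have h2 : ∀ n : ℕ, ∫ r, id r ∂(P.restrict (cycle 0 (n + 1 : ℕ))).map
      (fun c => (W coord x 0 (n + 1 : ℕ) c).toReal)
      = mean (W coord x 0 (n + 1 : ℕ)) (P.restrict (eventH coord (n + 1))) := fun n => by
    rw [integral_map (measurable_W x _ _).ereal_toReal.aemeasurable (by fun_prop)]
    rfl
  simp only [h2] at h1
  exact h1

end BernoulliLaw

/-! ### The growth rate -/

/-- The renewal sandwich, with `M n` cycles completed by time `n`. It is applied both to the weights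
and to `f n = n`. -/
theorem tendsto_div_of_bounds {S f : ℕ → ℝ} {M : ℕ → ℕ} {w C D : ℝ}
    (hS : Tendsto (fun n : ℕ => S n / n) atTop (𝓝 w)) (hM : Tendsto M atTop atTop)
    (hf : ∀ᶠ n in atTop, D + S (M n) ≤ f n ∧ f n ≤ C + S (M n + 1)) :
    Tendsto (fun n => f n / M n) atTop (𝓝 w) := by
  have hinv : ∀ r : ℝ, Tendsto (fun m : ℕ => r / (m : ℝ)) atTop (𝓝 0) := fun r =>
    tendsto_const_nhds.div_atTop tendsto_natCast_atTop_atTop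
  have h1 : Tendsto (fun m : ℕ => D / m + S m / m) atTop (𝓝 w) := by
    simpa using (hinv D).add hS
  have h2 : Tendsto (fun m : ℕ => C / m + S (m + 1) / m) atTop (𝓝 w) := by
    have h3 : Tendsto (fun m : ℕ => S (m + 1) / ((m + 1 : ℕ) : ℝ) * (1 + 1 / m)) atTop
        (𝓝 (w * (1 + 0))) :=
      ((tendsto_add_atTop_iff_nat 1).2 hS).mul (tendsto_const_nhds.add (hinv 1))
    have h4 : Tendsto (fun m : ℕ => S (m + 1) / m) atTop (𝓝 w) := by
      rw [add_zero, mul_one] at h3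
      refine h3.congr' ?_
      filter_upwards [eventually_gt_atTop 0] with m hm
      have : (m : ℝ) ≠ 0 := by exact_mod_cast hm.ne'
      push_cast
      field_simp
    simpa using (hinv C).add h4
  refine tendsto_of_tendsto_of_tendsto_of_le_of_le' (h1.comp hM) (h2.comp hM) ?_ ?_
  · filter_upwards [hf] with n hn
    simp only [Function.comp, ← add_div]
    exact div_le_div_of_nonneg_right hn.1 (Nat.cast_nonneg _)
  · filter_upwards [hf] with n hn
    simp only [Function.comp, ← add_div]
    exact div_le_div_of_nonneg_right hn.2 (Nat.cast_nonneg _)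

theorem tendsto_toReal_W_div {c : Cfg} {x : EReal} (hx : x < 2)
    (h01 : ∀ e, coord e c = 0 ∨ coord e c = 1) (hc : Unbounded (skeleton coord c)) {w τ : ℝ}
    (hτ : τ ≠ 0)
    (hw : Tendsto (fun n : ℕ => (∑ k ∈ Finset.range n, cycleWeight x (k + 1) c) / n) atTop (𝓝 w))
    (hl : Tendsto (fun n : ℕ => (∑ k ∈ Finset.range n,
      cycleValue (fun i j _ => (j - i : ℝ)) (k + 1) c) / n) atTop (𝓝 τ)) :
    (∀ᶠ n : ℕ in atTop, 0 ≤ W coord x 0 n c) ∧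
    Tendsto (fun n : ℕ => (W coord x 0 n c).toReal / n) atTop (𝓝 (w / τ)) := by
  have hm : StrictMono fun k => pt k c := enum_strictMono hc.2
  have hmem : ∀ k, pt k c ∈ skeleton coord c := enum_mem hc
  have h0 : pt 0 c ≤ 0 := (isGreatest_enum_zero hc.1).1.2
  have hpos : 0 < pt 1 c := enum_one_pos hc
  have hge : ∀ k : ℕ, (k : ℤ) ≤ pt (k + 1) c := by
    intro k
    induction k with
    | zero => exact hpos.le
    | succ k ih =>
      have h1 : pt (k + 1) c < pt (k + 1 + 1) c := hm (Nat.lt_succ_self _)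
      push_cast
      omega
  have hex : ∀ n : ℕ, ∃ k, (n : ℤ) < pt (k + 1 + 1) c := fun n =>
    ⟨n, (hge n).trans_lt (hm (Nat.lt_succ_self _))⟩
  classical
  -- For `n ≥ pt 1 c` this is the number of complete cycles between `pt 1 c` and `n`: `pt (M n + 1)
  -- c ≤ n < pt (M n + 2) c`.
  let M : ℕ → ℕ := fun n => Nat.find (hex n)
  have hM2 : ∀ n : ℕ, (n : ℤ) < pt (M n + 1 + 1) c := fun n => Nat.find_spec (hex n)
  have hM1 : ∀ n : ℕ, pt 1 c ≤ n → pt (M n + 1) c ≤ n := by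
    intro n hn
    rcases Nat.eq_zero_or_pos (M n) with h | h
    · rw [h]; exact hn
    · have := Nat.find_min (hex n) (m := M n - 1) (by change _ < M n; omega)
      rw [Nat.sub_add_cancel h] at this
      exact not_lt.1 this
  have hMtop : Tendsto M atTop atTop := by
    refine tendsto_atTop.2 fun b => ?_
    filter_upwards [eventually_ge_atTop (pt (b + 1) c).toNat] with n hn
    by_contra! hlt
    have h1 : pt (M n + 1 + 1) c ≤ pt (b + 1) c := hm.monotone (by omega)
    have := hM2 n
    omega
  have hlarge : ∀ᶠ n : ℕ in atTop, pt 1 c ≤ n := by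
    filter_upwards [eventually_ge_atTop (pt 1 c).toNat] with n hn
    omega
  have hsumlen : ∀ n : ℕ, ∑ k ∈ Finset.range n, cycleValue (fun i j _ => (j - i : ℝ)) (k + 1) c
      = pt (n + 1) c - pt 1 c := by
    intro n
    induction n with
    | zero => simp
    | succ n ih =>
      rw [Finset.sum_range_succ, ih, cycleValue]
      ring
  have hreach : ∀ n : ℕ, pt 1 c ≤ n → Reaches coord c 0 n := fun n hn =>
    (reaches_of_mem_skeleton_left (hmem 1) hpos.le).trans (reaches_of_mem_skeleton_right (hmem 1) hn)
  refine ⟨hlarge.mono fun n hn => (hreach n hn).W_nonneg, ?_⟩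
  have hA : Tendsto (fun n : ℕ => (W coord x 0 n c).toReal / M n) atTop (𝓝 w) := by
    refine tendsto_div_of_bounds (C := cycleWeight x 0 c) (D := 0) hw hMtop ?_
    filter_upwards [hlarge] with n hn
    have hW := coe_toReal_W hx h01 (hreach n hn)
    rw [zero_add, ← EReal.coe_le_coe_iff, ← EReal.coe_le_coe_iff, hW]
    constructor
    -- Lower bound: route through `pt 1 c` and `pt (M n + 1) c`; the two end pieces are joined by
    -- blue paths and weigh at least `0`.
    · calc _ ≤ W coord x (pt 1 c) (pt (M n + 1) c) c := sum_cycleWeight_le hx h01 hc (M n)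
        _ = 0 + W coord x (pt 1 c) (pt (M n + 1) c) c + 0 := by rw [zero_add, add_zero]
        _ ≤ W coord x 0 (pt 1 c) c + W coord x (pt 1 c) (pt (M n + 1) c) c
            + W coord x (pt (M n + 1) c) n c :=
          add_le_add (add_le_add (reaches_of_mem_skeleton_left (hmem 1) hpos.le).W_nonneg le_rfl)
            (reaches_of_mem_skeleton_right (hmem _) (hM1 n hn)).W_nonneg
        _ ≤ _ := (add_le_add (W_add_le x c _ _ _) le_rfl).trans (W_add_le x c _ _ _)
    -- Upper bound: prolong on both sides to skeleton points at nonnegative cost, then split. The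
    -- extra cycle, of index `0`, is the constant `C`.
    · calc W coord x 0 n c = 0 + W coord x 0 n c + 0 := by rw [zero_add, add_zero]
        _ ≤ W coord x (pt 0 c) 0 c + W coord x 0 n c + W coord x n (pt (M n + 1 + 1) c) c :=
          add_le_add (add_le_add (reaches_of_mem_skeleton_right (hmem 0) h0).W_nonneg le_rfl)
            (reaches_of_mem_skeleton_left (hmem _) (hM2 n).le).W_nonneg
        _ ≤ W coord x (pt 0 c) (pt (M n + 1 + 1) c) c :=
          (add_le_add (W_add_le x c _ _ _) le_rfl).trans (W_add_le x c _ _ _)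
        _ ≤ _ := le_sum_cycleWeight hx h01 hc _
        _ = _ := by rw [Finset.sum_range_succ', add_comm]
  have hB : Tendsto (fun n : ℕ => (n : ℝ) / M n) atTop (𝓝 τ) := by
    -- The lengths telescope to `pt (n + 1) c - pt 1 c`, hence both constants are `pt 1 c`.
    refine tendsto_div_of_bounds (C := pt 1 c) (D := pt 1 c) hl hMtop ?_
    filter_upwards [hlarge] with n hn
    rw [hsumlen, hsumlen, add_sub_cancel, add_sub_cancel]
    exact ⟨by exact_mod_cast hM1 n hn, by exact_mod_cast (hM2 n).le⟩
  refine (hA.div hB hτ).congr' ?_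
  filter_upwards [hMtop.eventually_gt_atTop 0] with n hn
  have : (M n : ℝ) ≠ 0 := by exact_mod_cast hn.ne'
  exact div_div_div_cancel_right₀ this _ _

theorem tendstoRate_of_ae {X : Type*} [MeasurableSpace X] {μ : Measure X} [IsProbabilityMeasure μ]
    {Y : ℕ → X → ℝ} {b r : ℝ} (hY : ∀ n, Measurable (Y n)) (hb : ∀ᵐ ω ∂μ, ∀ n : ℕ, |Y n ω| ≤ b * n)
    (h : ∀ᵐ ω ∂μ, Tendsto (fun n : ℕ => Y n ω / n) atTop (𝓝 r)) : TendstoRate μ Y r := by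
  refine ⟨h, fun n => ?_, ?_⟩
  · refine (integrable_const (b * n)).mono' (hY n).aestronglyMeasurable ?_
    filter_upwards [hb] with ω hω using hω n
  · simp only [eLpNorm_one_eq_lintegral_enorm]
    -- The linear bound on `Y n` makes `Y n / n` bounded, so the `L¹` limit follows by dominated
    -- convergence.
    have h1 := tendsto_lintegral_of_dominated_convergence (μ := μ)
      (F := fun (n : ℕ) ω => ‖Y n ω / n - r‖ₑ) (f := fun _ => 0)
      (fun _ => ENNReal.ofReal (|b| + |r|))
      (fun n => (((hY n).div_const _).sub_const _).enorm) (fun n => ?_) (by simp) ?_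
    · simpa using h1
    · filter_upwards [hb] with ω hω
      rw [Real.enorm_eq_ofReal_abs]
      refine ENNReal.ofReal_le_ofReal ((abs_sub _ _).trans (add_le_add_left ?_ _))
      rw [abs_div, Nat.abs_cast]
      refine div_le_of_le_mul₀ (Nat.cast_nonneg _) (abs_nonneg _) ((hω n).trans ?_)
      exact mul_le_mul_of_nonneg_right (le_abs_self b) (Nat.cast_nonneg _)
    · filter_upwards [h] with ω hω
      have := (hω.sub_const r).enorm
      simpa using this

theorem abs_toReal_W_le {c : Cfg} {x : EReal} (hx : x < 2) (hx' : x ≠ ⊥)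
    (h01 : ∀ e, coord e c = 0 ∨ coord e c = 1) (n : ℕ) :
    |(W coord x 0 n c).toReal| ≤ (2 + |x.toReal|) * n := by
  have hup := W_le_two_mul hx h01 0 n
  have hlo : ((-|x.toReal| * n : ℝ) : EReal) ≤ W coord x 0 n c := by
    rcases Nat.eq_zero_or_pos n with rfl | hn
    · simpa using W_self_nonneg x c 0
    · have hn' : (0 : ℤ) < n := by exact_mod_cast hn
      have hn1 : (1 : ℝ) ≤ n := by exact_mod_cast hn
      -- The single edge from `0` to `n` already weighs at least `-|x.toReal|`.
      refine le_trans ?_ (edgeWeight_le_W x c hn')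
      have hle : -|x.toReal| * n ≤ -|x.toReal| := by nlinarith [abs_nonneg x.toReal]
      rcases h01 ⟨(0, (n : ℤ)), hn'⟩ with h | h
      · rw [edgeWeight_of_eq_zero h, ← EReal.coe_toReal (hx.trans_le le_top).ne hx',
          EReal.coe_le_coe_iff, EReal.toReal_coe]
        exact hle.trans (neg_abs_le _)
      · rw [edgeWeight_of_eq_one h, ← EReal.coe_one, EReal.coe_le_coe_iff]
        linarith [abs_nonneg x.toReal]
  have hW : (((W coord x 0 n c).toReal : ℝ) : EReal) = W coord x 0 n c :=
    EReal.coe_toReal (hup.trans_lt (EReal.coe_lt_top _)).ne ((EReal.bot_lt_coe _).trans_le hlo).ne'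
  rw [← hW, EReal.coe_le_coe_iff] at hup hlo
  rw [abs_le]
  push_cast at hup
  constructor <;> nlinarith [abs_nonneg x.toReal, (Nat.cast_nonneg n : (0 : ℝ) ≤ n)]

theorem abs_toReal_max_W_le {c : Cfg} {x : EReal} (hx : x < 2)
    (h01 : ∀ e, coord e c = 0 ∨ coord e c = 1) (n : ℕ) :
    |(max (W coord x 0 n c) 0).toReal| ≤ 2 * n := by
  have h1 : max (W coord x 0 n c) 0 ≤ ((2 * n : ℝ) : EReal) := by
    refine max_le ?_ ?_
    · simpa using W_le_two_mul hx h01 0 n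
    · exact_mod_cast (by positivity : (0 : ℝ) ≤ 2 * n)
  have h2 : (((max (W coord x 0 n c) 0).toReal : ℝ) : EReal) = max (W coord x 0 n c) 0 :=
    EReal.coe_toReal (h1.trans_lt (EReal.coe_lt_top _)).ne
      ((EReal.bot_lt_coe 0).trans_le (le_max_right _ _)).ne'
  rw [abs_of_nonneg (EReal.toReal_nonneg (le_max_right _ _))]
  rwa [← h2, EReal.coe_le_coe_iff] at h1

namespace BernoulliLaw

variable {P : Measure Cfg} {p : ℝ} (hP : BernoulliLaw P p)
include hP

theorem isGrowthRate {x : EReal} (hx : x < 2) :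
    IsGrowthRate P coord x (γ p * ∫ r, r ∂weightLaw P x) := by
  have := hP.prob
  have hτ : (γ p)⁻¹ ≠ 0 := inv_ne_zero (gamma_pos hP.pos hP.lt_one).ne'
  have hA := hP.ae_tendsto_cycleValue (isCycleFunctional_W x) (hP.integrable_weightLaw hx)
  have hB := hP.ae_tendsto_cycleValue isCycleFunctional_length hP.integrable_lengthLaw
  rw [hP.integral_lengthLaw] at hB
  have hlim : ∀ᵐ c ∂P, (∀ᶠ n : ℕ in atTop, 0 ≤ W coord x 0 n c) ∧
      Tendsto (fun n : ℕ => (W coord x 0 n c).toReal / n) atTop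
        (𝓝 (γ p * ∫ r, r ∂weightLaw P x)) := by
    filter_upwards [hA, hB, hP.ae_unbounded, hP.ae_zero_or_one] with c hA hB hc h01
    have := tendsto_toReal_W_div hx h01 hc hτ hA hB
    rwa [div_inv_eq_mul, mul_comm] at this
  refine ⟨tendstoRate_of_ae (b := 2)
    (fun n => ((measurable_W x 0 n).max measurable_const).ereal_toReal) ?_ ?_,
    fun hx' => tendstoRate_of_ae (b := 2 + |x.toReal|)
      (fun n => (measurable_W x 0 n).ereal_toReal) ?_ (hlim.mono fun _ h => h.2)⟩
  · filter_upwards [hP.ae_zero_or_one] with c h01 n using abs_toReal_max_W_le hx h01 n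
  · filter_upwards [hlim] with c hc
    -- The weight is eventually nonnegative, so taking the positive part does not affect the limit.
    refine hc.2.congr' ?_
    filter_upwards [hc.1] with n hn
    rw [max_eq_left hn]
  · filter_upwards [hP.ae_zero_or_one] with c h01 n using abs_toReal_W_le hx hx' h01 n

theorem finiteIntegrable_W_pt {x : EReal} (hx : x < 2) :
    FiniteIntegrable (fun c => W coord x (pt 1 c) (pt 2 c) c) P := by
  refine ⟨?_, ?_⟩
  · filter_upwards [hP.ae_unbounded, hP.ae_zero_or_one] with c hc h01
    rw [← show _ = W coord x (pt 1 c) (pt 2 c) c from coe_cycleWeight hx h01 hc 1]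
    exact ⟨EReal.coe_ne_bot _, EReal.coe_ne_top _⟩
  · have h := hP.integrable_weightLaw hx
    rw [weightLaw, ← hP.map_cycleValue (isCycleFunctional_W x) le_rfl] at h
    exact (integrable_map_measure (by fun_prop)
      ((isCycleFunctional_W x).measurable_cycleValue 1).aemeasurable).1 h

theorem mean_W_pt (x : EReal) :
    mean (fun c => W coord x (pt 1 c) (pt 2 c) c) P = ∫ r, r ∂weightLaw P x := by
  rw [weightLaw, ← hP.map_cycleValue (isCycleFunctional_W x) le_rfl,
    integral_map ((isCycleFunctional_W x).measurable_cycleValue 1).aemeasurable (by fun_prop)]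
  rfl

theorem finiteIntegrable_W_pt_cond {x : EReal} (hx : x < 2) :
    FiniteIntegrable (fun c => W coord x (pt 0 c) (pt 1 c) c) P[|{c | pt 0 c = 0}] := by
  refine ⟨?_, ?_⟩
  · refine (cond_absolutelyContinuous : P[|{c | pt 0 c = 0}] ≪ P).ae_le ?_
    filter_upwards [hP.ae_unbounded, hP.ae_zero_or_one] with c hc h01
    rw [← show _ = W coord x (pt 0 c) (pt 1 c) c from coe_cycleWeight hx h01 hc 0]
    exact ⟨EReal.coe_ne_bot _, EReal.coe_ne_top _⟩
  · have h := hP.integrable_weightLaw hx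
    rw [weightLaw, ← hP.map_cond_cycleValue (isCycleFunctional_W x)] at h
    exact (integrable_map_measure (by fun_prop)
      ((isCycleFunctional_W x).measurable_cycleValue 0).aemeasurable).1 h

theorem mean_W_pt_cond (x : EReal) :
    mean (fun c => W coord x (pt 0 c) (pt 1 c) c) P[|{c | pt 0 c = 0}]
      = ∫ r, r ∂weightLaw P x := by
  rw [weightLaw, ← hP.map_cond_cycleValue (isCycleFunctional_W x),
    integral_map ((isCycleFunctional_W x).measurable_cycleValue 0).aemeasurable (by fun_prop)]
  rfl

theorem finiteIntegrable_W_cycle {x : EReal} (hx : x < 2) {n : ℕ} (hn : 1 ≤ n) :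
    FiniteIntegrable (W coord x 0 n) (P.restrict (eventH coord n)) := by
  have := hP.prob
  rw [eventH_coord]
  have hn' : (0 : ℤ) < n := by exact_mod_cast hn
  have hae : ∀ᵐ c ∂P.restrict (cycle 0 n), c ∈ cycle 0 n ∧ ∀ e, coord e c = 0 ∨ coord e c = 1 :=
    (ae_restrict_mem (measurableSet_cycle 0 n)).and (ae_restrict_of_ae hP.ae_zero_or_one)
  refine ⟨?_, (integrable_const (2 * n : ℝ)).mono'
    (measurable_W x 0 n).ereal_toReal.aestronglyMeasurable ?_⟩
  · filter_upwards [hae] with c hc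
    rw [← coe_toReal_W hx hc.2 (hc.1.1.1 n hn' le_rfl)]
    exact ⟨EReal.coe_ne_bot _, EReal.coe_ne_top _⟩
  · filter_upwards [hae] with c hc
    have h := toReal_W_mem hx hc.2 (hc.1.1.1 n hn' le_rfl)
    rw [Real.norm_of_nonneg h.1]
    simpa using h.2

end BernoulliLaw

/-! ### Transfer to an arbitrary probability space -/

section Transfer

variable {Ω : Type*} [MeasurableSpace Ω] {μ : Measure Ω}

/-- The configuration of a point of the probability space. -/
def config (α : Edge → Ω → ℝ) (ω : Ω) : Cfg := fun e => α e ω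

theorem measurable_config {α : Edge → Ω → ℝ} (hmeas : ∀ e, Measurable (α e)) :
    Measurable (config α) :=
  measurable_pi_lambda _ hmeas

/-- Skeleton, weights and events are functions of the configuration alone, so only its law matters.
-/
theorem bernoulliLaw_map_config [IsProbabilityMeasure μ] {p : ℝ} (hp0 : 0 < p) (hp1 : p < 1)
    {α : Edge → Ω → ℝ} (hmeas : ∀ e, Measurable (α e)) (hindep : iIndepFun α μ)
    (hone : ∀ e, μ {ω | α e ω = 1} = ENNReal.ofReal p)
    (hzero : ∀ e, μ {ω | α e ω = 0} = ENNReal.ofReal (1 - p)) :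
    BernoulliLaw (μ.map (config α)) p := by
  have hm := measurable_config hmeas
  have hprob : IsProbabilityMeasure (μ.map (config α)) := Measure.isProbabilityMeasure_map hm.aemeasurable
  refine ⟨hprob, hp0, hp1, ?_, fun e => ?_, fun e => ?_⟩
  · rw [iIndepFun_iff_map_fun_eq_infinitePi_map measurable_coord]
    have h1 := hindep.map_fun_eq_infinitePi_map hmeas
    have h2 : ∀ e, (μ.map (config α)).map (coord e) = μ.map (α e) := fun e => by
      rw [Measure.map_map (measurable_coord e) hm]; rfl
    simp only [h2]
    exact Measure.map_id.trans h1
  · rw [Measure.map_apply hm (measurableSet_setOfPred.2 (measurable_coord_eq e 1))]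
    exact hone e
  · rw [Measure.map_apply hm (measurableSet_setOfPred.2 (measurable_coord_eq e 0))]
    exact hzero e

variable {X : Type*} [MeasurableSpace X] {Φ : Ω → X}

theorem FiniteIntegrable.comp (hΦ : Measurable Φ) {f : X → EReal} (hf : Measurable f)
    (h : FiniteIntegrable f (μ.map Φ)) : FiniteIntegrable (fun ω => f (Φ ω)) μ :=
  ⟨ae_of_ae_map hΦ.aemeasurable h.1,
    (integrable_map_measure hf.ereal_toReal.aestronglyMeasurable hΦ.aemeasurable).1 h.2⟩

theorem mean_comp (hΦ : Measurable Φ) {f : X → EReal} (hf : Measurable f) :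
    mean (fun ω => f (Φ ω)) μ = mean f (μ.map Φ) :=
  (integral_map hΦ.aemeasurable hf.ereal_toReal.aestronglyMeasurable).symm

theorem TendstoRate.comp (hΦ : Measurable Φ) {Y : ℕ → X → ℝ} (hY : ∀ n, Measurable (Y n)) {r : ℝ}
    (h : TendstoRate (μ.map Φ) Y r) : TendstoRate μ (fun n ω => Y n (Φ ω)) r := by
  refine ⟨ae_of_ae_map hΦ.aemeasurable h.1, fun n =>
    (integrable_map_measure (hY n).aestronglyMeasurable hΦ.aemeasurable).1 (h.2.1 n), ?_⟩
  refine h.2.2.congr fun n => ?_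
  exact eLpNorm_map_measure (((hY n).div_const _).sub_const _).aestronglyMeasurable hΦ.aemeasurable

theorem map_cond_preimage (hΦ : Measurable Φ) {E : Set X} (hE : MeasurableSet E) :
    (μ[|Φ ⁻¹' E]).map Φ = (μ.map Φ)[|E] := by
  rw [ProbabilityTheory.cond, ProbabilityTheory.cond, Measure.map_smul, Measure.map_apply hΦ hE,
    Measure.restrict_map hΦ hE]

end Transfer

end BarakErdos
-- The growth rate formulas on an arbitrary probability space
theorem mainTheorem7 {Ω : Type*} [MeasurableSpace Ω] (μ : Measure Ω) [IsProbabilityMeasure μ]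
    (p : ℝ) (hp0 : 0 < p) (hp1 : p < 1)
    (α : BarakErdos.Edge → Ω → ℝ)
    (hmeas : ∀ e, Measurable (α e)) (hindep : iIndepFun α μ)
    (hone : ∀ e, μ {ω | α e ω = 1} = ENNReal.ofReal p)
    (hzero : ∀ e, μ {ω | α e ω = 0} = ENNReal.ofReal (1 - p))
    (x : EReal) (hx : x < 2) :
    -- `γ` is a convergent positive product and the rate of the skeleton points
    (Multipliable (fun k : ℕ => (1 - (1 - p) ^ (k + 1)) ^ 2) ∧ 0 < BarakErdos.γ p ∧
      ∀ i : ℤ, μ {ω | i ∈ BarakErdos.skeleton α ω} = ENNReal.ofReal (BarakErdos.γ p)) ∧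
    -- the enumeration of the skeleton points is almost surely well defined
    (∀ᵐ ω ∂μ,
      IsGreatest {s | s ∈ BarakErdos.skeleton α ω ∧ s ≤ 0} (BarakErdos.Γ α 0 ω) ∧
      ∀ k : ℕ, IsLeast {s | s ∈ BarakErdos.skeleton α ω ∧ BarakErdos.Γ α k ω < s}
        (BarakErdos.Γ α (k + 1) ω)) ∧
    -- all expectations exist
    BarakErdos.FiniteIntegrable
      (fun ω => BarakErdos.W α x (BarakErdos.Γ α 1 ω) (BarakErdos.Γ α 2 ω) ω) μ ∧
    BarakErdos.FiniteIntegrable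
      (fun ω => BarakErdos.W α x (BarakErdos.Γ α 0 ω) (BarakErdos.Γ α 1 ω) ω)
      μ[|{ω | BarakErdos.Γ α 0 ω = 0}] ∧
    (∀ n : ℕ, 1 ≤ n → BarakErdos.FiniteIntegrable (BarakErdos.W α x 0 n)
      (μ.restrict (BarakErdos.eventH α n))) ∧
    Summable (fun n : ℕ => BarakErdos.mean (BarakErdos.W α x 0 (n + 1 : ℕ))
      (μ.restrict (BarakErdos.eventH α (n + 1)))) ∧
    -- the growth rate exists and is given by the three formulas
    ∃ C : ℝ, BarakErdos.IsGrowthRate μ α x C ∧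
      C = BarakErdos.γ p * BarakErdos.mean
        (fun ω => BarakErdos.W α x (BarakErdos.Γ α 1 ω) (BarakErdos.Γ α 2 ω) ω) μ ∧
      C = BarakErdos.γ p * BarakErdos.mean
        (fun ω => BarakErdos.W α x (BarakErdos.Γ α 0 ω) (BarakErdos.Γ α 1 ω) ω)
        μ[|{ω | BarakErdos.Γ α 0 ω = 0}] ∧
      C = BarakErdos.γ p * ∑' n : ℕ, BarakErdos.mean (BarakErdos.W α x 0 (n + 1 : ℕ))
        (μ.restrict (BarakErdos.eventH α (n + 1))) := by
  have hΦ := BarakErdos.measurable_config hmeas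
  have hP := BarakErdos.bernoulliLaw_map_config hp0 hp1 hmeas hindep hone hzero
  have hΓ : BarakErdos.Γ α = fun k ω => BarakErdos.pt k (BarakErdos.config α ω) := by
    funext k ω
    exact BarakErdos.Γ_eq_enum α ω k
  simp only [hΓ]
  have hm12 := BarakErdos.measurable_comp_pt (BarakErdos.measurable_W x) 1 2
  have hm01 := BarakErdos.measurable_comp_pt (BarakErdos.measurable_W x) 0 1
  have hE : MeasurableSet {c | BarakErdos.pt 0 c = 0} :=
    BarakErdos.measurable_pt 0 (measurableSet_singleton 0)
  have hcond := BarakErdos.map_cond_preimage (μ := μ) hΦ hE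
  -- By definition `eventH α n` is the preimage under `config α` of the event for `coord`; the
  -- closing `rfl`s below rest on the same identification for `W` and the skeleton.
  have hH : ∀ n, (μ.restrict (BarakErdos.eventH α n)).map (BarakErdos.config α)
      = (μ.map (BarakErdos.config α)).restrict (BarakErdos.eventH BarakErdos.coord n) := fun n =>
    (Measure.restrict_map hΦ (BarakErdos.measurableSet_cycle 0 n)).symm
  have hmean : ∀ n : ℕ, BarakErdos.mean (BarakErdos.W α x 0 (n + 1 : ℕ))
      (μ.restrict (BarakErdos.eventH α (n + 1)))
      = BarakErdos.mean (BarakErdos.W BarakErdos.coord x 0 (n + 1 : ℕ))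
        ((μ.map (BarakErdos.config α)).restrict (BarakErdos.eventH BarakErdos.coord (n + 1))) := by
    intro n
    rw [← hH]
    exact BarakErdos.mean_comp hΦ (BarakErdos.measurable_W x 0 (n + 1 : ℕ))
  have hsum := hP.hasSum_weightLaw hx
  simp only [hmean]
  refine ⟨⟨BarakErdos.multipliable_gamma hp0 hp1, BarakErdos.gamma_pos hp0 hp1, fun i => ?_⟩, ?_,
    (hP.finiteIntegrable_W_pt hx).comp hΦ hm12, ?_, fun n hn => ?_, hsum.summable,
    BarakErdos.γ p * ∫ r, r ∂BarakErdos.weightLaw (μ.map (BarakErdos.config α)) x,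
    ⟨?_, fun hx' => ?_⟩, ?_, ?_, ?_⟩
  · rw [← hP.prob_mem_skeleton i, Measure.map_apply hΦ
      (measurableSet_setOfPred.2 (BarakErdos.measurable_mem_skeleton i))]
    rfl
  · filter_upwards [ae_of_ae_map hΦ.aemeasurable hP.ae_unbounded] with ω hω
    exact ⟨BarakErdos.isGreatest_enum_zero hω.1, fun k => BarakErdos.isLeast_enum_succ hω.2 k⟩
  · refine BarakErdos.FiniteIntegrable.comp hΦ hm01 ?_
    exact hcond.symm ▸ hP.finiteIntegrable_W_pt_cond hx
  · refine BarakErdos.FiniteIntegrable.comp hΦ (BarakErdos.measurable_W x 0 n) ?_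
    rw [hH]
    exact hP.finiteIntegrable_W_cycle hx hn
  · exact (hP.isGrowthRate hx).1.comp hΦ fun n =>
      ((BarakErdos.measurable_W x 0 n).max measurable_const).ereal_toReal
  · exact ((hP.isGrowthRate hx).2 hx').comp hΦ fun n =>
      (BarakErdos.measurable_W x 0 n).ereal_toReal
  · rw [← hP.mean_W_pt x, ← BarakErdos.mean_comp hΦ hm12]
    rfl
  · rw [← hP.mean_W_pt_cond x, ← hcond, ← BarakErdos.mean_comp hΦ hm01]
    rfl
  · rw [hsum.tsum_eq]
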